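/- **Setting.** Let $0<\alpha<1$ and $0<\varepsilon<1$. For a graph $G$ and a vertex $s$, the personalized PageRank vector $\pi(s,\cdot)$ is the unique solution of $\pi_s=\alpha e_s+(1-\alpha)W^{\top}\pi_s$, where $W$ is the transition matrix of the walk that moves to a uniformly random out-neighbour (and to $s$ from a vertex without out-neighbours). An undirected edge counts as two directed edges. Let $G_0,\dots,G_k$ be graphs, each obtained from the previous one by one edge update, and write $\pi_i$ for personalized PageRank on $G_i$, $n$ for the number of vertices and $\bar d$ for the average (out-)degree of $G_0$. **Algorithm (Dynamic Reverse Push).** For a target $t$ keep estimates $P(\cdot)$ and residuals $R(\cdot)$, initially $P=0$, $R=e_t$. *Push at $u$* on a graph $G$: with $r=R(u)$, increase $P(u)$ by $\alpha r$, set $R(u)$ to $0$, and add $(1-\alpha)r/d^{out}(v)$ to $R(v)$ for every in-neighbour $v$ of $u$ (an isolated vertex, where the walk stays put, counts as its own only in-neighbour). *Local push*: while some $R(u)>\varepsilon$, push at any such $u$; then, while some $R(u)<-\varepsilon$, push at any such $u$. When an edge $u\to v$ is inserted, add $$\frac{(1-\alpha)P(v)-P(u)-\alpha R(u)+\alpha\mathbf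 1_{u=t}}{\alpha\, d^{out}(u)}$$ to $R(u)$, with $d^{out}(u)$ taken in the updated graph; when it is deleted, subtract this quantity (if $u$ has become isolated, set $R(u)=\mathbf 1_{u=t}-P(u)$ instead). For an undirected edge do this for both directions. A local push is run on $G_0$ and after each of the $k$ updates; let $P_i(s,t)$ be the estimates when the local push on $G_i$ ends. Running time: a push at $u$ costs $1+d^{in}(u)$ (isolated $u$: $1$), and the start, each insertion/deletion step and each passage to the second loop cost $1$. Let $T(t)$ be the total running time for target $t$, in the worst case over the choices of pushed vertices ($\infty$ if the algorithm can fail to terminate). **Theorem.** There is an absolute constant $C$ such that the following holds in both models below, with $B:=C\left(\dfrac{k}{\alpha^{2}}+\dfrac{k}{n\varepsilon\alpha^{2}}+\dfrac{\bar d}{\alpha\varepsilon}\right)$. 1. *Arbitrary edge updates of an undirected graph.* $G_0$ is a finite simple undirected graph, with at least one vertex and without isolated vertices, and $G_i$ is obtained from $G_{i-1}$ by deleting or adding an arbitrary edge (new vertices may occur, and vertices may become isolated). Then for every vertex $t$ of $G_0$, every $i\le k$, every vertex $s$ and every execution, $|P_i(s,t)-\pi_i(s,t)|\le\varepsilon$;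 and for $t$ uniformly random in $V(G_0)$, $\mathbb E[T(t)]\le B$. 2. *Random edge permutation of a directed graph.* The vertex set is a fixed finite nonempty set of $n$ vertices. The $m+k$ edges of a directed graph are put in uniformly random order, and $G_i$ consists of the first $m+i$ of them (so $\bar d=m/n$). Let $A$ be the event that in $G_0$ every vertex has in-degree and out-degree at least one. On $A$, for every target $t$, every $i\le k$, every vertex $s$ and every execution, $|P_i(s,t)-\pi_i(s,t)|\le\varepsilon$; and for an independent uniformly random vertex $t$, $\mathbb E[T(t)\,\mathbf 1_A]\le B$ (so $\mathbb E[T(t)]\le B$ if $A$ always holds). -/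

import Mathlib

open scoped ENNReal

namespace DynamicPush

section Graphs

variable {V : Type*} [DecidableEq V]

/-- A directed unweighted graph on `V` is given by its finite set of edges `x → y`. This is the
out-degree. -/
def outDeg (E : Finset (V × V)) (x : V) : ℕ := (E.filter (fun e => e.1 = x)).card

/-- The in-degree. -/
def inDeg (E : Finset (V × V)) (x : V) : ℕ := (E.filter (fun e => e.2 = x)).card

/-- Every vertex has an in-neighbour and an out-neighbour. -/
def NoDangling (E : Finset (V × V)) : Prop := ∀ x : V, 0 < inDeg E x ∧ 0 < outDeg E x

/-- Transition probability from `x` to `y` of the walk with source `s`: go to a uniformly random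
out-neighbour; a vertex without out-neighbours sends the walk to `s`. -/
noncomputable def walk (E : Finset (V × V)) (s x y : V) : ℝ :=
  if outDeg E x = 0 then (if y = s then 1 else 0)
  else if (x, y) ∈ E then 1 / (outDeg E x : ℝ) else 0

theorem walk_nonneg (E : Finset (V × V)) (s x y : V) : 0 ≤ walk E s x y := by
  unfold walk
  split_ifs <;> positivity

variable [Fintype V]

instance (E : Finset (V × V)) : Decidable (NoDangling E) :=
  inferInstanceAs (Decidable (∀ x : V, 0 < inDeg E x ∧ 0 < outDeg E x))

/-- The linear system `p = α e_s + (1 - α) Wᵀ p` of the personalized PageRank vector of source `s`,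
where `W` is the transition matrix. -/
def IsPPR (E : Finset (V × V)) (α : ℝ) (s : V) (p : V → ℝ) : Prop :=
  ∀ y, p y = α * (if y = s then 1 else 0) + (1 - α) * ∑ x, p x * walk E s x y

/-- The matrix `I - (1 - α) Wᵀ` of that system. -/
noncomputable def pprMatrix (E : Finset (V × V)) (α : ℝ) (s : V) : Matrix V V ℝ :=
  1 - (1 - α) • (Matrix.of (walk E s)).transpose

/-- Personalized PageRank: `ppr E α s t` is `π(s, t)`. By `isPPR_iff` below it is the unique solution
of the linear system. -/
noncomputable def ppr (E : Finset (V × V)) (α : ℝ) (s : V) : V → ℝ :=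
  (pprMatrix E α s)⁻¹.mulVec (fun y => α * (if y = s then 1 else 0))

theorem sum_walk (E : Finset (V × V)) (s x : V) : ∑ y, walk E s x y = 1 := by
  unfold walk
  by_cases h : outDeg E x = 0
  · simp [h]
  · simp only [h, if_false]
    rw [← Finset.sum_filter, Finset.sum_const, nsmul_eq_mul]
    have hc : (Finset.univ.filter (fun y => (x, y) ∈ E)).card = outDeg E x := by
      unfold outDeg
      refine Finset.card_bij (fun y _ => (x, y)) ?_ ?_ ?_
      · intro y hy; simpa using hy
      · intro a _ b _ hab; simpa using hab
      · rintro ⟨a, b⟩ hab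
        simp only [Finset.mem_filter] at hab
        obtain ⟨h1, rfl⟩ := hab
        exact ⟨b, by simpa using h1, rfl⟩
    rw [hc]
    have : (outDeg E x : ℝ) ≠ 0 := by exact_mod_cast h
    field_simp

theorem pprMatrix_det_ne_zero (E : Finset (V × V)) {α : ℝ} (h0 : 0 < α) (h1 : α < 1) (s : V) :
    (pprMatrix E α s).det ≠ 0 := by
  apply det_ne_zero_of_sum_col_lt_diag
  intro x
  have hs := sum_walk E s x
  rw [← Finset.add_sum_erase _ _ (Finset.mem_univ x)] at hs
  have hoff : ∑ i ∈ Finset.univ.erase x, ‖pprMatrix E α s i x‖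
      = (1 - α) * ∑ i ∈ Finset.univ.erase x, walk E s x i := by
    rw [Finset.mul_sum]
    refine Finset.sum_congr rfl fun i hi => ?_
    have hne : i ≠ x := Finset.ne_of_mem_erase hi
    have : pprMatrix E α s i x = -((1 - α) * walk E s x i) := by
      simp [pprMatrix, hne]
    rw [this, norm_neg, Real.norm_of_nonneg]
    exact mul_nonneg (by linarith) (walk_nonneg E s x i)
  have hdiag : pprMatrix E α s x x = 1 - (1 - α) * walk E s x x := by
    simp [pprMatrix]
  have hn : 0 ≤ ∑ i ∈ Finset.univ.erase x, walk E s x i :=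
    Finset.sum_nonneg fun i _ => walk_nonneg E s x i
  rw [hoff, hdiag]
  refine lt_of_lt_of_le ?_ (le_abs_self _)
  nlinarith [walk_nonneg E s x x]

theorem isPPR_iff (E : Finset (V × V)) {α : ℝ} (h0 : 0 < α) (h1 : α < 1) (s : V) (p : V → ℝ) :
    IsPPR E α s p ↔ p = ppr E α s := by
  have hu : IsUnit (pprMatrix E α s).det := isUnit_iff_ne_zero.2 (pprMatrix_det_ne_zero E h0 h1 s)
  have key : IsPPR E α s p ↔
      (pprMatrix E α s).mulVec p = fun y => α * (if y = s then 1 else 0) := by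
    rw [funext_iff]
    refine forall_congr' fun y => ?_
    have : (pprMatrix E α s).mulVec p y = p y - (1 - α) * ∑ x, p x * walk E s x y := by
      rw [pprMatrix, Matrix.sub_mulVec, Matrix.one_mulVec, Matrix.smul_mulVec, Pi.sub_apply,
        Pi.smul_apply, smul_eq_mul]
      congr 2
      exact Finset.sum_congr rfl fun x _ => mul_comm (walk E s x y) (p x)
    rw [this]
    constructor <;> intro h <;> linarith
  rw [key]
  constructor
  · intro h
    rw [ppr, ← h, Matrix.mulVec_mulVec, Matrix.nonsing_inv_mul _ hu, Matrix.one_mulVec]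
  · rintro rfl
    rw [ppr, Matrix.mulVec_mulVec, Matrix.mul_nonsing_inv _ hu, Matrix.one_mulVec]

end Graphs

section Algorithm

variable {V : Type*} [DecidableEq V]

/-- What the algorithm stores for a target `t`: the estimates `P(·, t)` and residuals `R(·, t)`. -/
structure State (V : Type*) where
  est : V → ℝ
  res : V → ℝ

/-- Initially `P = 0` and `R = e_t`. -/
def initState (t : V) : State V := ⟨fun _ => 0, fun x => if x = t then 1 else 0⟩

/-- `RevPush(u)`: an `α` fraction of the residual `r` of `u` moves to the estimate of `u`, the
residual of `u` is cleared, and each in-neighbour `x` of `u` receives `(1 - α) r / outdeg x`. At an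
isolated vertex the walk started there stays there, so such a vertex counts as its own only
in-neighbour. -/
noncomputable def revPush (E : Finset (V × V)) (α : ℝ) (u : V) (S : State V) : State V where
  est := Function.update S.est u (S.est u + α * S.res u)
  res := fun x => (if x = u then 0 else S.res x) +
    (if (x, u) ∈ E then (1 - α) * S.res u / (outDeg E x : ℝ)
     else if x = u ∧ outDeg E u = 0 then (1 - α) * S.res u else 0)

/-- The amount by which the residual of `u` is corrected when `u → v` changes; `E` is the updated
graph. -/
noncomputable def correction (E : Finset (V × V)) (α : ℝ) (t u v : V) (S : State V) : ℝ :=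
  ((1 - α) * S.est v - S.est u - α * S.res u + α * (if u = t then 1 else 0))
    / (outDeg E u : ℝ) * (1 / α)

/-- `Insert(u, v)`, with `E` the updated graph. -/
noncomputable def insertEdge (E : Finset (V × V)) (α : ℝ) (t u v : V) (S : State V) : State V :=
  ⟨S.est, Function.update S.res u (S.res u + correction E α t u v S)⟩

/-- `Delete(u, v)`, with `E` the updated graph. If `u` has lost its last out-neighbour (where the
correction would divide by zero), then its residual is set to the value `1_{u=t} - P(u, t)` that
restores the invariant at a vertex where the walk stays put. -/
noncomputable def deleteEdge (E : Finset (V × V)) (α : ℝ) (t u v : V) (S : State V) : State V :=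
  ⟨S.est, Function.update S.res u
    (if outDeg E u = 0 then (if u = t then 1 else 0) - S.est u
     else S.res u - correction E α t u v S)⟩

/-- Insert or Delete for the directed edge `u → v` that was just added or removed; `E` is the updated
graph. -/
noncomputable def updateEdge (E : Finset (V × V)) (α : ℝ) (t u v : V) (S : State V) : State V :=
  if (u, v) ∈ E then insertEdge E α t u v S else deleteEdge E α t u v S

/-- The two loops of a local push: first positive, then negative residuals are pushed. -/
inductive Phase
  | pos
  | neg

/-- The executions of the dynamic algorithm for the target `t` on the graphs `E 0, …, E k`, where
`upd i` is the Insert/Delete step that is applied on the passage from `E i` to `E (i + 1)`.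
`Run E upd k α ε t c i ph S` says that some execution spends `c` time units and is then in phase
`ph` of the local push on `E i`, with stored vectors `S`. Any vertex whose residual exceeds the
threshold may be chosen for the next push. A push at `u` costs `1` plus the number of in-neighbours of
`u`; starting, passing to the second loop and Insert/Delete cost `1` each. -/
inductive Run (E : ℕ → Finset (V × V)) (upd : ℕ → State V → State V) (k : ℕ) (α ε : ℝ) (t : V) :
    ℕ → ℕ → Phase → State V → Prop
  | start : Run E upd k α ε t 1 0 Phase.pos (initState t)
  | pushPos {c i : ℕ} {S : State V} (u : V) (h : Run E upd k α ε t c i Phase.pos S)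
      (hu : ε < S.res u) :
      Run E upd k α ε t (c + (1 + inDeg (E i) u)) i Phase.pos (revPush (E i) α u S)
  | toNeg {c i : ℕ} {S : State V} (h : Run E upd k α ε t c i Phase.pos S)
      (hS : ∀ u, S.res u ≤ ε) : Run E upd k α ε t (c + 1) i Phase.neg S
  | pushNeg {c i : ℕ} {S : State V} (u : V) (h : Run E upd k α ε t c i Phase.neg S)
      (hu : S.res u < -ε) :
      Run E upd k α ε t (c + (1 + inDeg (E i) u)) i Phase.neg (revPush (E i) α u S)
  | update {c i : ℕ} {S : State V} (h : Run E upd k α ε t c i Phase.neg S)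
      (hS : ∀ u, -ε ≤ S.res u) (hi : i < k) :
      Run E upd k α ε t (c + 1) (i + 1) Phase.pos (upd i S)

/-- The total running time for the target `t`, in the worst case over the choices of the pushed
vertices: the supremum of the time spent by complete or partial executions. It is `∞` if some execution
does not terminate, because every step costs at least one unit. -/
noncomputable def runningTime (E : ℕ → Finset (V × V)) (upd : ℕ → State V → State V) (k : ℕ)
    (α ε : ℝ) (t : V) : ℝ≥0∞ :=
  ⨆ (c : ℕ) (_ : ∃ i ph S, Run E upd k α ε t c i ph S), (c : ℝ≥0∞)

/-- In every execution, whenever the local push on `E i` has ended, the estimates for the target `t`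
have additive error at most `ε` on `E i`. -/
def Accurate [Fintype V] (E : ℕ → Finset (V × V)) (upd : ℕ → State V → State V) (k : ℕ) (α ε : ℝ)
    (t : V) : Prop :=
  ∀ (c i : ℕ) (S : State V), Run E upd k α ε t c i Phase.neg S → (∀ u, -ε ≤ S.res u) →
    ∀ s : V, |S.est s - ppr (E i) α s t| ≤ ε

end Algorithm

section Undirected

variable {V : Type*}

/-- Undirected graphs under edge updates: the update `e i` deletes the edge between `(e i).1` and
`(e i).2` if it is present, and adds it otherwise. -/
def graphSeq (G₀ : SimpleGraph V) (e : ℕ → V × V) : ℕ → SimpleGraph V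
  | 0 => G₀
  | i + 1 => symmDiff (graphSeq G₀ e i) (SimpleGraph.edge (e i).1 (e i).2)

variable [Fintype V]

open Classical in
/-- Both orientations of all the edges of an undirected graph. -/
noncomputable def arcs (G : SimpleGraph V) : Finset (V × V) :=
  Finset.univ.filter (fun p => G.Adj p.1 p.2)

/-- Dynamic undirected graph as a sequence of edge sets. -/
noncomputable def undirSeq (G₀ : SimpleGraph V) (e : ℕ → V × V) (i : ℕ) : Finset (V × V) :=
  arcs (graphSeq G₀ e i)

variable [DecidableEq V]

/-- For an undirected edge Insert/Delete is applied in both directions. -/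
noncomputable def undirUpdate (G₀ : SimpleGraph V) (e : ℕ → V × V) (α : ℝ) (t : V) (i : ℕ)
    (S : State V) : State V :=
  updateEdge (undirSeq G₀ e (i + 1)) α t (e i).2 (e i).1
    (updateEdge (undirSeq G₀ e (i + 1)) α t (e i).1 (e i).2 S)

end Undirected

section Directed

variable {V : Type*} [DecidableEq V]

/-- An ordering `σ` of the edges of the final graph `E`; the graph `i` consists of the first
`m + i` edges. -/
def permSeq {E : Finset (V × V)} {m k : ℕ} (σ : Fin (m + k) ≃ E) (i : ℕ) : Finset (V × V) :=
  (Finset.univ.filter (fun j : Fin (m + k) => (j : ℕ) < m + i)).image (fun j => (σ j : V × V))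

/-- Passage from graph `i` to graph `i + 1`: insertion of the next edge of the ordering. -/
noncomputable def permUpdate {E : Finset (V × V)} {m k : ℕ} (σ : Fin (m + k) ≃ E) (α : ℝ) (t : V)
    (i : ℕ) (S : State V) : State V :=
  if h : i < k then
    updateEdge (permSeq σ (i + 1)) α t (σ ⟨m + i, by omega⟩ : V × V).1
      (σ ⟨m + i, by omega⟩ : V × V).2 S
  else S

end Directed

end DynamicPush

/-! Let W be the transition matrix of the lazy walk, which stays put where there is no out-edge.
Reverse push keeps the invariant P + αR = αe_t + (1-α)WP, and an insertion or deletion changes R by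
exactly what the changed rows of W require. Pairing the invariant with π(s,·) gives π(s,t) = P(s) +
∑ π(s,x) R(x). The error is thus a π-average of residuals, hence at most ε once all |R(x)| ≤ ε
(`ppr_eq_est_add`, `abs_est_sub_ppr_le`). The jump of a dangling vertex to s may be replaced by the
lazy loop because dangling vertices are isolated in both models (`ppr_mul_walk`).

For the time, use the potential ∑ w(x)|R(x)| with a weight w satisfying 1 + d^in(u) + (1-α)(wW)(u) ≤
w(u). A push at u lowers it by at least |R(u)|(1 + d^in(u)), which exceeds ε times the cost of the
push. The total time is therefore O(k) plus 1/ε times the initial potential and the growth at the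
updates (`Run.mul_cost_add_le`, `runningTime_le`).

In an undirected graph w = (2/α)·max(1, deg) works, since the walk preserves degrees. The degree
cancels the division in the correction, so an update costs O((P(u) + P(v) + 1_{t∈{u,v}})/α +
ε)·(1/α), with absolute values on the estimates. Since |P(s)| ≤ π(s,t) + ε and ∑_t π(s,t) = 1,
averaging over t leaves O(1/n + ε)/α² per update.

In a directed graph w = (1/α)∑_u (1 + d^in(u)) π(u,·) solves the weight condition with equality.
Inserting u → v moves w by at most (1 + 2q)/α in ℓ¹, and the correction costs q times the same kind
of bracket, where q = w(u)/d^out(u) in the new graph. Given the edge set of the new graph, its last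
edge is uniform, so the mean of q is ∑_x w(x)/|E| = (n + |E|)/(α|E|) ≤ 2/α when there is no dangling
vertex (`sum_last_edge_mul`, `sum_lastEdgeLoad_le`). -/

namespace DynamicPush

/-! ### The lazy walk: row changes under edge updates, degree identities. -/

section LazyWalk

variable {V : Type*} [DecidableEq V]

/-- Transition probability of the walk that stays put at a vertex without out-neighbours. -/
noncomputable def lazyWalk (E : Finset (V × V)) (x y : V) : ℝ := walk E x x y

theorem lazyWalk_nonneg (E : Finset (V × V)) (x y : V) : 0 ≤ lazyWalk E x y :=
  walk_nonneg E x x y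

theorem sum_lazyWalk [Fintype V] (E : Finset (V × V)) (x : V) : ∑ y, lazyWalk E x y = 1 :=
  sum_walk E x x

theorem outDeg_ne_zero_of_mem {E : Finset (V × V)} {x y : V} (h : (x, y) ∈ E) :
    outDeg E x ≠ 0 := by
  unfold outDeg
  exact Finset.card_ne_zero_of_mem (a := (x, y)) (by simp [h])

theorem inDeg_ne_zero_of_mem {E : Finset (V × V)} {x y : V} (h : (x, y) ∈ E) :
    inDeg E y ≠ 0 := by
  unfold inDeg
  exact Finset.card_ne_zero_of_mem (a := (x, y)) (by simp [h])

theorem outDeg_congr {E E' : Finset (V × V)} {x : V} (h : ∀ y, (x, y) ∈ E' ↔ (x, y) ∈ E) :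
    outDeg E' x = outDeg E x := by
  unfold outDeg
  congr 1
  ext ⟨a, b⟩
  simp only [Finset.mem_filter]
  constructor
  · rintro ⟨h1, rfl⟩
    exact ⟨(h b).1 h1, rfl⟩
  · rintro ⟨h1, rfl⟩
    exact ⟨(h b).2 h1, rfl⟩

theorem lazyWalk_congr {E E' : Finset (V × V)} {x : V} (h : ∀ y, (x, y) ∈ E' ↔ (x, y) ∈ E)
    (y : V) : lazyWalk E' x y = lazyWalk E x y := by
  simp only [lazyWalk, walk, outDeg_congr h, h]

theorem outDeg_insert {E E' : Finset (V × V)} {u v : V}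
    (h : ∀ y, (u, y) ∈ E' ↔ (u, y) ∈ E ∨ y = v) (hv : (u, v) ∉ E) :
    outDeg E' u = outDeg E u + 1 := by
  unfold outDeg
  rw [← Finset.card_insert_of_notMem (a := (u, v)) (by simp [hv])]
  congr 1
  ext ⟨a, b⟩
  simp only [Finset.mem_filter, Finset.mem_insert, Prod.mk.injEq]
  constructor
  · rintro ⟨h1, rfl⟩
    rcases (h b).1 h1 with h2 | h2
    · exact Or.inr ⟨h2, rfl⟩
    · exact Or.inl ⟨rfl, h2⟩
  · rintro (⟨rfl, rfl⟩ | ⟨h1, rfl⟩)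
    · exact ⟨(h _).2 (Or.inr rfl), rfl⟩
    · exact ⟨(h _).2 (Or.inl h1), rfl⟩

/-- The new row is the average of the old row, with weight 1 - 1/d', and the point mass at v, with
weight 1/d', where d' is the new degree. The lazy convention makes this hold also for the first
out-edge: then d' = 1 and the loop is replaced entirely. -/
theorem lazyWalk_insert {E E' : Finset (V × V)} {u v : V}
    (h : ∀ y, (u, y) ∈ E' ↔ (u, y) ∈ E ∨ y = v) (hv : (u, v) ∉ E) (y : V) :
    lazyWalk E' u y =
      lazyWalk E u y + ((if y = v then 1 else 0) - lazyWalk E u y) / (outDeg E' u : ℝ) := by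
  have hd := outDeg_insert h hv
  have hd0 : outDeg E' u ≠ 0 := by omega
  by_cases h0 : outDeg E u = 0
  · have hE : (u, y) ∉ E := fun hm => outDeg_ne_zero_of_mem hm h0
    have hd1 : outDeg E' u = 1 := by omega
    have hm : (u, y) ∈ E' ↔ y = v := by simp [h, hE]
    simp [lazyWalk, walk, hd1, hm]
  · have hc : (outDeg E' u : ℝ) = outDeg E u + 1 := by exact_mod_cast hd
    have hp : (outDeg E u : ℝ) ≠ 0 := by exact_mod_cast h0
    have hp' : (outDeg E u : ℝ) + 1 ≠ 0 := by positivity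
    simp only [lazyWalk, walk, hd0, h0, if_false, hc]
    by_cases hy : y = v
    · subst hy
      simp [h, hv]
    · by_cases hE : (u, y) ∈ E
      · simp only [(h y).2 (Or.inl hE), hE, hy, if_true, if_false]
        field_simp
        ring
      · have : (u, y) ∉ E' := by simp [h, hE, hy]
        simp [this, hE, hy]

theorem lazyWalk_delete {E E' : Finset (V × V)} {u v : V}
    (h : ∀ y, (u, y) ∈ E ↔ (u, y) ∈ E' ∨ y = v) (hv : (u, v) ∉ E') (h0 : outDeg E' u ≠ 0)
    (y : V) :
    lazyWalk E' u y =
      lazyWalk E u y - ((if y = v then 1 else 0) - lazyWalk E u y) / (outDeg E' u : ℝ) := by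
  rw [lazyWalk_insert h hv y]
  have hc : (outDeg E u : ℝ) = outDeg E' u + 1 := by exact_mod_cast outDeg_insert h hv
  have hp : (outDeg E' u : ℝ) ≠ 0 := by exact_mod_cast h0
  have hp' : (outDeg E' u : ℝ) + 1 ≠ 0 := by positivity
  rw [hc]
  field_simp
  ring

theorem lazyWalk_of_outDeg_eq_zero {E : Finset (V × V)} {x : V} (h : outDeg E x = 0) (y : V) :
    lazyWalk E x y = if y = x then 1 else 0 := by
  simp [lazyWalk, walk, h]

theorem outDeg_eq_sum [Fintype V] (E : Finset (V × V)) (x : V) :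
    outDeg E x = ∑ y, if (x, y) ∈ E then 1 else 0 := by
  rw [← Finset.card_filter]
  unfold outDeg
  symm
  refine Finset.card_bij (fun y _ => (x, y)) (by simp) (by simp) ?_
  rintro ⟨a, b⟩ hab
  simp only [Finset.mem_filter] at hab
  obtain ⟨h1, rfl⟩ := hab
  exact ⟨b, by simpa using h1, rfl⟩

theorem inDeg_eq_sum [Fintype V] (E : Finset (V × V)) (y : V) :
    inDeg E y = ∑ x, if (x, y) ∈ E then 1 else 0 := by
  rw [← Finset.card_filter]
  unfold inDeg
  symm
  refine Finset.card_bij (fun x _ => (x, y)) (by simp) (by simp) ?_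
  rintro ⟨a, b⟩ hab
  simp only [Finset.mem_filter] at hab
  obtain ⟨h1, rfl⟩ := hab
  exact ⟨a, by simpa using h1, rfl⟩

theorem sum_outDeg [Fintype V] (E : Finset (V × V)) : ∑ x, outDeg E x = E.card :=
  (Finset.card_eq_sum_card_fiberwise (f := Prod.fst) (t := Finset.univ) (by simp)).symm

theorem sum_inDeg [Fintype V] (E : Finset (V × V)) : ∑ x, inDeg E x = E.card :=
  (Finset.card_eq_sum_card_fiberwise (f := Prod.snd) (t := Finset.univ) (by simp)).symm

/-- The out-degree, with a loop added at vertices without out-neighbours, is transported by the lazy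
walk to the in-degree, with the same convention. -/
theorem sum_max_outDeg_mul_lazyWalk [Fintype V] (E : Finset (V × V)) (y : V) :
    ∑ x, max 1 (outDeg E x : ℝ) * lazyWalk E x y =
      inDeg E y + if outDeg E y = 0 then 1 else 0 := by
  have key : ∀ x, max 1 (outDeg E x : ℝ) * lazyWalk E x y =
      (if (x, y) ∈ E then 1 else 0) + if x = y then (if outDeg E y = 0 then 1 else 0) else 0 := by
    intro x
    by_cases h0 : outDeg E x = 0
    · have hm : (x, y) ∉ E := fun hm => outDeg_ne_zero_of_mem hm h0
      rw [lazyWalk_of_outDeg_eq_zero h0]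
      by_cases hxy : x = y
      · subst hxy
        simp [h0, hm]
      · simp [h0, hm, hxy, Ne.symm hxy]
    · have h1 : (1 : ℝ) ≤ outDeg E x := by exact_mod_cast Nat.one_le_iff_ne_zero.2 h0
      have h2 : (outDeg E x : ℝ) ≠ 0 := by positivity
      rw [max_eq_right h1]
      have h3 : (if x = y then (if outDeg E y = 0 then (1 : ℝ) else 0) else 0) = 0 := by
        split_ifs with h4 h5
        · exact absurd (h4 ▸ h5) h0
        · rfl
        · rfl
      rw [h3]
      simp only [lazyWalk, walk, h0, if_false]
      split_ifs <;> simp [h2]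
  rw [Finset.sum_congr rfl fun x _ => key x, Finset.sum_add_distrib, inDeg_eq_sum]
  simp

end LazyWalk

/-! ### Personalized PageRank as a probability vector, and its lazy form. -/

section PageRank

variable {V : Type*} [DecidableEq V] [Fintype V]

/-- An `ℓ¹`-contraction estimate for the affine equation `p = b + (1 - α) Wᵀ p`. -/
theorem sum_abs_le_of_eq_add {V : Type*} [Fintype V] {α : ℝ} (h1 : α < 1) {W : V → V → ℝ} (hW : ∀ x y, 0 ≤ W x y)
    (hW1 : ∀ x, ∑ y, W x y = 1) {p b : V → ℝ}
    (hp : ∀ y, p y = b y + (1 - α) * ∑ x, p x * W x y) :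
    α * ∑ y, |p y| ≤ ∑ y, |b y| := by
  have h : ∑ y, |p y| ≤ ∑ y, |b y| + (1 - α) * ∑ x, |p x| := by
    calc ∑ y, |p y| ≤ ∑ y, (|b y| + (1 - α) * ∑ x, |p x| * W x y) := by
          refine Finset.sum_le_sum fun y _ => ?_
          conv_lhs => rw [hp y]
          refine (abs_add_le _ _).trans (add_le_add le_rfl ?_)
          rw [abs_mul, abs_of_nonneg (by linarith : 0 ≤ 1 - α)]
          refine mul_le_mul_of_nonneg_left ?_ (by linarith)
          refine (Finset.abs_sum_le_sum_abs _ _).trans (le_of_eq ?_)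
          exact Finset.sum_congr rfl fun x _ => by rw [abs_mul, abs_of_nonneg (hW x y)]
      _ = ∑ y, |b y| + (1 - α) * ∑ x, |p x| := by
          rw [Finset.sum_add_distrib, ← Finset.mul_sum, Finset.sum_comm]
          congr 2
          exact Finset.sum_congr rfl fun x _ => by rw [← Finset.mul_sum, hW1, mul_one]
  linarith

variable {E : Finset (V × V)} {α : ℝ}

theorem isPPR_ppr (E : Finset (V × V)) (h0 : 0 < α) (h1 : α < 1) (s : V) :
    IsPPR E α s (ppr E α s) :=
  (isPPR_iff E h0 h1 s _).2 rfl

theorem sum_ppr (E : Finset (V × V)) (h0 : 0 < α) (h1 : α < 1) (s : V) :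
    ∑ y, ppr E α s y = 1 := by
  have h : ∑ y, ppr E α s y = α + (1 - α) * ∑ x, ppr E α s x := by
    conv_lhs => rw [Finset.sum_congr rfl fun y _ => isPPR_ppr E h0 h1 s y]
    rw [Finset.sum_add_distrib, ← Finset.mul_sum, ← Finset.mul_sum, Finset.sum_comm]
    congr 1
    · simp
    · congr 1
      exact Finset.sum_congr rfl fun x _ => by rw [← Finset.mul_sum, sum_walk, mul_one]
  have : α * (∑ y, ppr E α s y - 1) = 0 := by linarith
  rcases mul_eq_zero.1 this with h2 | h2 <;> linarith

/-- The ℓ¹ contraction gives ∑|π| ≤ 1 = ∑ π, which leaves no room for a negative entry. -/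
theorem ppr_nonneg (E : Finset (V × V)) (h0 : 0 < α) (h1 : α < 1) (s y : V) :
    0 ≤ ppr E α s y := by
  have h := sum_abs_le_of_eq_add h1 (walk_nonneg E s) (sum_walk E s) (isPPR_ppr E h0 h1 s)
  have hb : ∑ y, |α * (if y = s then (1 : ℝ) else 0)| = α := by
    simp only [abs_of_pos h0, apply_ite abs, abs_zero, mul_ite, mul_one,
      mul_zero, Finset.sum_ite_eq', Finset.mem_univ, if_true]
  rw [hb] at h
  have hle : ∑ y, |ppr E α s y| ≤ 1 := by
    by_contra hc
    push Not at hc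
    nlinarith
  have hz : ∑ y, (|ppr E α s y| - ppr E α s y) ≤ 0 := by
    rw [Finset.sum_sub_distrib, sum_ppr E h0 h1 s]
    linarith
  have hnn : ∀ z ∈ Finset.univ, 0 ≤ |ppr E α s z| - ppr E α s z :=
    fun z _ => sub_nonneg.2 (le_abs_self _)
  have := (Finset.single_le_sum hnn (Finset.mem_univ y)).trans hz
  linarith [abs_nonneg (ppr E α s y)]

/-- Every vertex without out-neighbours is isolated. -/
def DanglingIsolated (E : Finset (V × V)) : Prop := ∀ x : V, outDeg E x = 0 → inDeg E x = 0

theorem NoDangling.danglingIsolated {V : Type*} [DecidableEq V] {E : Finset (V × V)} (h : NoDangling E) : DanglingIsolated E :=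
  fun x hx => absurd hx (h x).2.ne'

/-- The two walks differ only at vertices without out-edges. Such a vertex other than s is isolated,
so nothing reaches it and it carries no mass; at s itself jumping to s and staying put coincide. -/
theorem ppr_mul_walk (hE : DanglingIsolated E) (h0 : 0 < α) (h1 : α < 1) (s x y : V) :
    ppr E α s x * walk E s x y = ppr E α s x * lazyWalk E x y := by
  by_cases hx : x = s
  · subst hx
    rfl
  · by_cases hd : outDeg E x = 0
    · have hin := hE x hd
      have : ppr E α s x = 0 := by
        rw [isPPR_ppr E h0 h1 s x]
        have : ∀ z, walk E s z x = 0 := by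
          intro z
          have hz : (z, x) ∉ E := fun hm => inDeg_ne_zero_of_mem hm hin
          simp [walk, hx, hz]
        simp [this, hx]
      rw [this, zero_mul, zero_mul]
    · simp [lazyWalk, walk, hd]

theorem ppr_eq_lazy (hE : DanglingIsolated E) (h0 : 0 < α) (h1 : α < 1) (s y : V) :
    ppr E α s y = α * (if y = s then 1 else 0) +
      (1 - α) * ∑ x, ppr E α s x * lazyWalk E x y := by
  conv_lhs => rw [isPPR_ppr E h0 h1 s y]
  rw [Finset.sum_congr rfl fun x _ => ppr_mul_walk hE h0 h1 s x y]

end PageRank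

/-! ### The push invariant and the accuracy it implies. -/

section Invariant

/-- The self-loop rule for isolated vertices is the lazy walk, so one formula covers all cases of a
push. -/
theorem revPush_res {V : Type*} [DecidableEq V] (E : Finset (V × V)) (α : ℝ) (u : V) (S : State V) (x : V) :
    (revPush E α u S).res x =
      (if x = u then 0 else S.res x) + (1 - α) * S.res u * lazyWalk E x u := by
  unfold revPush
  simp only
  congr 1
  by_cases h : (x, u) ∈ E
  · simp only [h, if_true, lazyWalk, walk, outDeg_ne_zero_of_mem h, if_false]
    ring
  · by_cases hx : x = u
    · subst hx
      by_cases hd : outDeg E x = 0 <;> simp [h, hd, lazyWalk, walk]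
    · by_cases hd : outDeg E x = 0 <;> simp [h, hd, hx, Ne.symm hx, lazyWalk, walk]

variable {V : Type*} [DecidableEq V] [Fintype V] {E E' : Finset (V × V)} {α ε : ℝ} {t : V}
  {S : State V}

/-- The invariant of reverse push at the vertex `x`. -/
def RowInvariant (E : Finset (V × V)) (α : ℝ) (t : V) (S : State V) (x : V) : Prop :=
  S.est x + α * S.res x =
    α * (if x = t then 1 else 0) + (1 - α) * ∑ y, lazyWalk E x y * S.est y

theorem rowInvariant_initState (E : Finset (V × V)) (α : ℝ) (t x : V) :
    RowInvariant E α t (initState t) x := by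
  simp [RowInvariant, initState]

/-- With r = R(u), raising P(u) by αr adds (1-α)αr·W(x,u) on the right, which is α times the
residual sent to x. At x = u the gain αr in the estimate also cancels the loss of the residual r. -/
theorem RowInvariant.revPush {x : V} (h : RowInvariant E α t S x) (u : V) :
    RowInvariant E α t (revPush E α u S) x := by
  unfold RowInvariant at h ⊢
  rw [revPush_res]
  have hsum : ∑ y, lazyWalk E x y * (DynamicPush.revPush E α u S).est y =
      ∑ y, lazyWalk E x y * S.est y + lazyWalk E x u * (α * S.res u) := by
    have : ∀ y, lazyWalk E x y * (DynamicPush.revPush E α u S).est y =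
        lazyWalk E x y * S.est y + if y = u then lazyWalk E x u * (α * S.res u) else 0 := by
      intro y
      by_cases hy : y = u
      · subst hy
        simp [DynamicPush.revPush, mul_add]
      · simp [DynamicPush.revPush, hy]
    rw [Finset.sum_congr rfl fun y _ => this y, Finset.sum_add_distrib]
    simp
  rw [hsum]
  by_cases hx : x = u
  · subst hx
    simp only [DynamicPush.revPush, Function.update_self, if_true]
    linear_combination h
  · simp only [DynamicPush.revPush, Function.update_of_ne hx, hx, if_false]
    linear_combination h

/-- The estimates and residuals determine the personalized PageRank to the target. -/
theorem ppr_eq_est_add (hE : DanglingIsolated E) (h0 : 0 < α) (h1 : α < 1)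
    (hS : ∀ x, RowInvariant E α t S x) (s : V) :
    ppr E α s t = S.est s + ∑ x, ppr E α s x * S.res x := by
  set p := ppr E α s with hp
  -- The invariant is summed against π(s,·); the PageRank equation, which is its adjoint, then
  -- eliminates the transition matrix.
  have hA : ∑ x, p x * (S.est x + α * S.res x) =
      α * p t + (1 - α) * ∑ y, (∑ x, p x * lazyWalk E x y) * S.est y := by
    have : ∀ x, p x * (S.est x + α * S.res x) =
        (if x = t then α * p t else 0) + (1 - α) * ∑ y, p x * lazyWalk E x y * S.est y := by
      intro x
      rw [hS x, mul_add]
      congr 1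
      · split_ifs with hx
        · rw [hx]; ring
        · ring
      · rw [mul_left_comm, Finset.mul_sum]
        simp only [mul_assoc]
    rw [Finset.sum_congr rfl fun x _ => this x, Finset.sum_add_distrib, ← Finset.mul_sum,
      Finset.sum_comm]
    simp [Finset.sum_mul]
  have hB : (1 - α) * ∑ y, (∑ x, p x * lazyWalk E x y) * S.est y =
      ∑ y, p y * S.est y - α * S.est s := by
    have : ∀ y, (1 - α) * ((∑ x, p x * lazyWalk E x y) * S.est y) =
        p y * S.est y - if y = s then α * S.est s else 0 := by
      intro y
      have := ppr_eq_lazy hE h0 h1 s y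
      rw [← hp] at this
      rw [this]
      split_ifs with hy
      · rw [hy]; ring
      · ring
    rw [Finset.mul_sum, Finset.sum_congr rfl fun y _ => this y, Finset.sum_sub_distrib]
    simp
  have hC : ∑ x, p x * (S.est x + α * S.res x) =
      ∑ x, p x * S.est x + α * ∑ x, p x * S.res x := by
    rw [Finset.mul_sum, ← Finset.sum_add_distrib]
    exact Finset.sum_congr rfl fun x _ => by ring
  have : α * (p t - (S.est s + ∑ x, p x * S.res x)) = 0 := by
    rw [hB] at hA
    linear_combination hC - hA
  rcases mul_eq_zero.1 this with h | h <;> linarith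

theorem abs_est_sub_ppr_le (hE : DanglingIsolated E) (h0 : 0 < α) (h1 : α < 1)
    (hS : ∀ x, RowInvariant E α t S x) (hR : ∀ x, |S.res x| ≤ ε) (s : V) :
    |S.est s - ppr E α s t| ≤ ε := by
  rw [ppr_eq_est_add hE h0 h1 hS s, sub_add_cancel_left, abs_neg]
  calc |∑ x, ppr E α s x * S.res x| ≤ ∑ x, |ppr E α s x * S.res x| :=
        Finset.abs_sum_le_sum_abs _ _
    _ ≤ ∑ x, ppr E α s x * ε := by
        refine Finset.sum_le_sum fun x _ => ?_
        rw [abs_mul, abs_of_nonneg (ppr_nonneg E h0 h1 s x)]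
        exact mul_le_mul_of_nonneg_left (hR x) (ppr_nonneg E h0 h1 s x)
    _ = ε := by rw [← Finset.sum_mul, sum_ppr E h0 h1, one_mul]

end Invariant

/-! ### Insertions and deletions: invariant and size of the correction. -/

section Update

variable {V : Type*} [DecidableEq V] {E E' : Finset (V × V)} {α : ℝ} {t u v : V} {S : State V}

theorem updateEdge_est (E : Finset (V × V)) (α : ℝ) (t u v : V) (S : State V) :
    (updateEdge E α t u v S).est = S.est := by
  unfold updateEdge
  split_ifs <;> rfl

theorem updateEdge_res_of_ne (E : Finset (V × V)) (α : ℝ) (t v : V) (S : State V) {x : V}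
    (h : x ≠ u) : (updateEdge E α t u v S).res x = S.res x := by
  unfold updateEdge
  split_ifs <;> simp [insertEdge, deleteEdge, h]

/-- Weighting by the degree cancels the division by it, so the bound is free of degrees. At degree 0
the left side vanishes. -/
theorem outDeg_mul_abs_correction_le (E : Finset (V × V)) (h0 : 0 < α) (h1 : α < 1) (t u v : V)
    (S : State V) :
    outDeg E u * |correction E α t u v S| ≤
      (|S.est v| + |S.est u| + if u = t then 1 else 0) / α + |S.res u| := by
  set j : ℝ := if u = t then 1 else 0 with hj
  have hj0 : 0 ≤ j := by rw [hj]; split_ifs <;> norm_num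
  have hrhs : 0 ≤ (|S.est v| + |S.est u| + j) / α + |S.res u| := by positivity
  by_cases hd : (outDeg E u : ℝ) = 0
  · rw [hd, zero_mul]
    exact hrhs
  · have hpos : 0 < (outDeg E u : ℝ) := lt_of_le_of_ne (by positivity) (Ne.symm hd)
    unfold correction
    rw [← hj, abs_mul, abs_div, abs_of_pos hpos, abs_of_pos (by positivity : 0 < 1 / α)]
    have hnum : |(1 - α) * S.est v - S.est u - α * S.res u + α * j| ≤
        |S.est v| + |S.est u| + α * |S.res u| + j := by
      have e1 : |(1 - α) * S.est v| ≤ |S.est v| := by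
        rw [abs_mul, abs_of_nonneg (by linarith : 0 ≤ 1 - α)]
        nlinarith [abs_nonneg (S.est v)]
      have e2 : |α * S.res u| = α * |S.res u| := by rw [abs_mul, abs_of_pos h0]
      have e3 : |α * j| ≤ j := by
        rw [abs_of_nonneg (by positivity)]
        nlinarith
      have := abs_add_le ((1 - α) * S.est v - S.est u - α * S.res u) (α * j)
      have := abs_sub ((1 - α) * S.est v - S.est u) (α * S.res u)
      have := abs_sub ((1 - α) * S.est v) (S.est u)
      linarith
    calc (outDeg E u : ℝ) * (|(1 - α) * S.est v - S.est u - α * S.res u + α * j| / outDeg E u *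
          (1 / α)) = |(1 - α) * S.est v - S.est u - α * S.res u + α * j| / α := by
          field_simp
      _ ≤ (|S.est v| + |S.est u| + α * |S.res u| + j) / α := by gcongr
      _ = _ := by field_simp; ring

/-- The out-neighbourhoods of `u` in the two graphs differ exactly in `v`. -/
def TogglesOut (E E' : Finset (V × V)) (u v : V) : Prop :=
  ∀ y, (u, y) ∈ E' ↔ ((u, y) ∈ E ↔ y ≠ v)

theorem TogglesOut.mem_insert (h : TogglesOut E E' u v) (hv : (u, v) ∈ E') :
    (u, v) ∉ E ∧ ∀ y, (u, y) ∈ E' ↔ (u, y) ∈ E ∨ y = v := by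
  have h1 : (u, v) ∉ E := by simpa using (h v).1 hv
  refine ⟨h1, fun y => ?_⟩
  by_cases hy : y = v
  · subst hy
    simp [hv]
  · have := h y
    tauto

theorem TogglesOut.mem_delete (h : TogglesOut E E' u v) (hv : (u, v) ∉ E') :
    ∀ y, (u, y) ∈ E ↔ (u, y) ∈ E' ∨ y = v := by
  intro y
  by_cases hy : y = v
  · subst hy
    have := h y
    tauto
  · have := h y
    tauto

/-- The new row average of P is M ± (P(v) - M)/d', where M is the old one. The old invariant
expresses (1-α)M through P(u), R(u) and 1_{u=t}, and solving for the new residual gives precisely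
the correction. -/
theorem RowInvariant.updateEdge [Fintype V] (h0 : 0 < α) (h : TogglesOut E E' u v)
    (hS : RowInvariant E α t S u) : RowInvariant E' α t (updateEdge E' α t u v S) u := by
  have hsum : ∀ a : ℝ, ∑ y, (lazyWalk E u y + a * ((if y = v then 1 else 0) - lazyWalk E u y)) *
      S.est y = ∑ y, lazyWalk E u y * S.est y +
        a * (S.est v - ∑ y, lazyWalk E u y * S.est y) := by
    intro a
    have : ∀ y, (lazyWalk E u y + a * ((if y = v then 1 else 0) - lazyWalk E u y)) * S.est y =
        lazyWalk E u y * S.est y + a * ((if y = v then S.est v else 0) -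
          lazyWalk E u y * S.est y) := by
      intro y
      split_ifs with hy
      · rw [hy]; ring
      · ring
    rw [Finset.sum_congr rfl fun y _ => this y, Finset.sum_add_distrib, ← Finset.mul_sum,
      Finset.sum_sub_distrib]
    simp
  unfold RowInvariant at hS ⊢
  rw [updateEdge_est]
  set M := ∑ y, lazyWalk E u y * S.est y with hM
  by_cases hv : (u, v) ∈ E'
  · obtain ⟨h1, h2⟩ := h.mem_insert hv
    have hd : (outDeg E' u : ℝ) ≠ 0 := by
      exact_mod_cast outDeg_ne_zero_of_mem hv
    have hN : ∑ y, lazyWalk E' u y * S.est y = M + (1 / (outDeg E' u : ℝ)) * (S.est v - M) := by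
      rw [hM, ← hsum]
      refine Finset.sum_congr rfl fun y _ => ?_
      rw [lazyWalk_insert h2 h1 y]
      ring
    rw [hN]
    simp only [DynamicPush.updateEdge, hv, if_true, insertEdge, Function.update_self, correction]
    field_simp
    linear_combination ((outDeg E' u : ℝ) - 1) * hS
  · have h2 := h.mem_delete hv
    simp only [DynamicPush.updateEdge, hv, if_false, deleteEdge, Function.update_self]
    by_cases hd : outDeg E' u = 0
    · have hN : ∑ y, lazyWalk E' u y * S.est y = S.est u := by
        simp [lazyWalk_of_outDeg_eq_zero hd]
      rw [hN]
      simp only [hd, if_true]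
      ring
    · have hN : ∑ y, lazyWalk E' u y * S.est y =
          M + (-(1 / (outDeg E' u : ℝ))) * (S.est v - M) := by
        rw [hM, ← hsum]
        refine Finset.sum_congr rfl fun y _ => ?_
        rw [lazyWalk_delete h2 hv hd y]
        ring
      have hd' : (outDeg E' u : ℝ) ≠ 0 := by exact_mod_cast hd
      rw [hN]
      simp only [hd, if_false, correction]
      field_simp
      linear_combination ((outDeg E' u : ℝ) + 1) * hS

theorem RowInvariant.congr [Fintype V] {S' : State V} {x : V}
    (h : ∀ y, (x, y) ∈ E' ↔ (x, y) ∈ E) (he : S'.est = S.est) (hr : S'.res x = S.res x)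
    (hS : RowInvariant E α t S x) : RowInvariant E' α t S' x := by
  unfold RowInvariant at hS ⊢
  simp only [he, hr, hS, lazyWalk_congr h]

/-- An insertion raises the weight by at most one, costing one |R(u)|, and the correction
contributes the second. The maximum with 1 keeps isolated vertices charged. -/
theorem max_outDeg_mul_abs_updateEdge_res_le (h0 : 0 < α) (h1 : α < 1)
    (h : TogglesOut E E' u v) :
    max 1 (outDeg E' u : ℝ) * |(updateEdge E' α t u v S).res u| ≤
      max 1 (outDeg E u : ℝ) * |S.res u| +
        ((|S.est v| + |S.est u| + if u = t then 1 else 0) / α + 2 * |S.res u|) := by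
  have hc := outDeg_mul_abs_correction_le E' h0 h1 t u v S
  set j : ℝ := if u = t then 1 else 0 with hj
  have hj0 : 0 ≤ j := by rw [hj]; split_ifs <;> norm_num
  by_cases hv : (u, v) ∈ E'
  · obtain ⟨h1, h2⟩ := h.mem_insert hv
    have hd : (outDeg E' u : ℝ) = outDeg E u + 1 := by exact_mod_cast outDeg_insert h2 h1
    have hd1 : (1 : ℝ) ≤ outDeg E' u := by rw [hd]; linarith [(outDeg E u).cast_nonneg (α := ℝ)]
    simp only [updateEdge, hv, if_true, insertEdge, Function.update_self]
    rw [max_eq_right hd1]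
    have e1 : (outDeg E' u : ℝ) * |S.res u + correction E' α t u v S| ≤
        outDeg E' u * |S.res u| + outDeg E' u * |correction E' α t u v S| := by
      rw [← mul_add]
      exact mul_le_mul_of_nonneg_left (abs_add_le _ _) (by linarith)
    have e2 : (outDeg E' u : ℝ) * |S.res u| ≤ max 1 (outDeg E u : ℝ) * |S.res u| + |S.res u| := by
      rw [hd, add_mul, one_mul]
      gcongr
      exact le_max_right _ _
    linarith
  · have h2 := h.mem_delete hv
    simp only [updateEdge, hv, if_false, deleteEdge, Function.update_self]
    -- If u becomes isolated, its residual is reset and its weight is 1; the reset value is absorbed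
    -- into the first bracket because 1 ≤ 1/α.
    by_cases hd : outDeg E' u = 0
    · simp only [hd, if_true, Nat.cast_zero, max_eq_left zero_le_one, one_mul]
      rw [← hj]
      have e1 := abs_sub j (S.est u)
      rw [abs_of_nonneg hj0] at e1
      have e2 : |S.est v| + |S.est u| + j ≤ (|S.est v| + |S.est u| + j) / α := by
        rw [le_div_iff₀ h0]
        have : 0 ≤ |S.est v| + |S.est u| + j := by positivity
        nlinarith
      have e3 : 0 ≤ max 1 (outDeg E u : ℝ) * |S.res u| := by positivity
      linarith [abs_nonneg (S.est v), abs_nonneg (S.res u)]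
    · have hd' : (outDeg E u : ℝ) = outDeg E' u + 1 := by exact_mod_cast outDeg_insert h2 hv
      have hd1 : (1 : ℝ) ≤ outDeg E' u := by exact_mod_cast Nat.one_le_iff_ne_zero.2 hd
      simp only [hd, if_false]
      rw [max_eq_right hd1]
      have e1 : (outDeg E' u : ℝ) * |S.res u - correction E' α t u v S| ≤
          outDeg E' u * |S.res u| + outDeg E' u * |correction E' α t u v S| := by
        rw [← mul_add]
        exact mul_le_mul_of_nonneg_left (abs_sub _ _) (by linarith)
      have e2 : (outDeg E' u : ℝ) * |S.res u| ≤ max 1 (outDeg E u : ℝ) * |S.res u| := by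
        gcongr
        exact le_max_of_le_right (by linarith)
      linarith [abs_nonneg (S.res u)]

end Update

/-! ### Amortized analysis with a weighted residual potential. -/

section Cost

variable {V : Type*} [DecidableEq V] [Fintype V]

/-- The push removes w(u)|r| and sends out at most (1-α)|r|·∑ w(x) W(x,u), where r = R(u); the
weight condition `hu` says that the difference pays for the push. -/
theorem sum_mul_abs_revPush_res_add_le {E : Finset (V × V)} {α : ℝ} (h1 : α < 1) {w : V → ℝ}
    (hw : ∀ x, 0 ≤ w x) {u : V}
    (hu : (1 + inDeg E u : ℝ) + (1 - α) * ∑ x, w x * lazyWalk E x u ≤ w u) (S : State V) :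
    ∑ x, w x * |(revPush E α u S).res x| + |S.res u| * (1 + inDeg E u) ≤
      ∑ x, w x * |S.res x| := by
  have hx : ∀ x, w x * |(revPush E α u S).res x| ≤
      (w x * |S.res x| - if x = u then w u * |S.res u| else 0) +
        (1 - α) * |S.res u| * (w x * lazyWalk E x u) := by
    intro x
    rw [revPush_res]
    have e1 := abs_add_le (if x = u then 0 else S.res x) ((1 - α) * S.res u * lazyWalk E x u)
    rw [abs_mul, abs_mul (1 - α), abs_of_nonneg (lazyWalk_nonneg E x u),
      abs_of_nonneg (by linarith : 0 ≤ 1 - α)] at e1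
    have e2 := mul_le_mul_of_nonneg_left e1 (hw x)
    refine e2.trans (le_of_eq ?_)
    split_ifs with h
    · subst h
      rw [abs_zero]
      ring
    · ring
  have hsum := Finset.sum_le_sum fun x (_ : x ∈ Finset.univ) => hx x
  rw [Finset.sum_add_distrib, Finset.sum_sub_distrib, ← Finset.mul_sum] at hsum
  simp only [Finset.sum_ite_eq', Finset.mem_univ, if_true] at hsum
  have := mul_le_mul_of_nonneg_left hu (abs_nonneg (S.res u))
  linarith

variable {E : ℕ → Finset (V × V)} {upd : ℕ → State V → State V} {k : ℕ} {α ε : ℝ} {t : V}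
  {c i : ℕ} {ph : Phase} {S : State V}

/-- Negative pushes only send nonpositive amounts and clear a negative residual to 0, so the upper
bound ε reached by the first loop survives the second. -/
theorem Run.invariant (h1 : α < 1) (hε : 0 < ε)
    (hupd : ∀ i < k, ∀ S, (∀ x, RowInvariant (E i) α t S x) →
      ∀ x, RowInvariant (E (i + 1)) α t (upd i S) x)
    (h : Run E upd k α ε t c i ph S) :
    i ≤ k ∧ (∀ x, RowInvariant (E i) α t S x) ∧ (ph = Phase.neg → ∀ u, S.res u ≤ ε) := by
  induction h with
  | start => exact ⟨k.zero_le, rowInvariant_initState _ _ _, nofun⟩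
  | pushPos u _ _ ih => exact ⟨ih.1, fun x => (ih.2.1 x).revPush u, nofun⟩
  | toNeg _ hS ih => exact ⟨ih.1, ih.2.1, fun _ => hS⟩
  | @pushNeg c i S u _ hu ih =>
    refine ⟨ih.1, fun x => (ih.2.1 x).revPush u, fun _ x => ?_⟩
    rw [revPush_res]
    have e1 : (1 - α) * S.res u * lazyWalk (E i) x u ≤ 0 :=
      mul_nonpos_of_nonpos_of_nonneg
        (mul_nonpos_of_nonneg_of_nonpos (by linarith) (by linarith)) (lazyWalk_nonneg _ _ _)
    have e2 := ih.2.2 rfl x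
    split_ifs <;> linarith
  | update _ _ hi ih => exact ⟨hi, hupd _ hi _ ih.2.1, nofun⟩

theorem accurate_of_rowInvariant (h0 : 0 < α) (h1 : α < 1) (hε : 0 < ε)
    (hE : ∀ i ≤ k, DanglingIsolated (E i))
    (hupd : ∀ i < k, ∀ S, (∀ x, RowInvariant (E i) α t S x) →
      ∀ x, RowInvariant (E (i + 1)) α t (upd i S) x) :
    Accurate E upd k α ε t := by
  intro c i S h hS s
  obtain ⟨hi, hinv, hneg⟩ := h.invariant h1 hε hupd
  exact abs_est_sub_ppr_le (hE i hi) h0 h1 hinv (fun x => abs_le.2 ⟨hS x, hneg rfl x⟩) s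

/-- The cost of passing from the start of a local push to a given phase. -/
noncomputable def Phase.cost : Phase → ℝ
  | .pos => 0
  | .neg => 1

/-- Amortized cost of an execution, with the potential `∑ x, w i x * |R x|`. -/
theorem Run.mul_cost_add_le (h1 : α < 1) (hε : 0 < ε)
    (hupd : ∀ i < k, ∀ S, (∀ x, RowInvariant (E i) α t S x) →
      ∀ x, RowInvariant (E (i + 1)) α t (upd i S) x)
    {w : ℕ → V → ℝ} (hw : ∀ i ≤ k, ∀ x, 0 ≤ w i x)
    (hpush : ∀ i ≤ k, ∀ u,
      (1 + inDeg (E i) u : ℝ) + (1 - α) * ∑ x, w i x * lazyWalk (E i) x u ≤ w i u)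
    {δ : ℕ → ℝ}
    (hpot : ∀ i < k, ∀ S, (∀ x, RowInvariant (E i) α t S x) → (∀ x, |S.res x| ≤ ε) →
      ∑ x, w (i + 1) x * |(upd i S).res x| ≤ ∑ x, w i x * |S.res x| + δ i)
    (h : Run E upd k α ε t c i ph S) :
    ε * c + ∑ x, w i x * |S.res x| ≤
      ε * (1 + 2 * i + ph.cost) + w 0 t +
        ∑ j ∈ Finset.range i, δ j := by
  induction h with
  | start =>
    simp [initState, apply_ite abs, Phase.cost]
  | @pushPos c i S u hr hu ih =>
    have hi := (hr.invariant h1 hε hupd).1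
    have hp := sum_mul_abs_revPush_res_add_le h1 (hw i hi) (hpush i hi u) S
    -- The loop condition makes the potential drop at least ε times the cost of this push.
    have : ε * (1 + inDeg (E i) u) ≤ |S.res u| * (1 + inDeg (E i) u) :=
      mul_le_mul_of_nonneg_right (hu.le.trans (le_abs_self _)) (by positivity)
    push_cast
    linarith
  | toNeg _ _ ih =>
    push_cast
    simp only [Phase.cost] at ih ⊢
    linarith
  | @pushNeg c i S u hr hu ih =>
    have hi := (hr.invariant h1 hε hupd).1
    have hp := sum_mul_abs_revPush_res_add_le h1 (hw i hi) (hpush i hi u) S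
    have : ε * (1 + inDeg (E i) u) ≤ |S.res u| * (1 + inDeg (E i) u) :=
      mul_le_mul_of_nonneg_right (by linarith [neg_le_abs (S.res u)]) (by positivity)
    push_cast
    linarith
  | @update c i S hr hS hi ih =>
    obtain ⟨-, hinv, hneg⟩ := hr.invariant h1 hε hupd
    have hp := hpot i hi S hinv fun x => abs_le.2 ⟨hS x, hneg rfl x⟩
    rw [Finset.sum_range_succ]
    push_cast
    simp only [Phase.cost] at ih ⊢
    linarith

/-- The term 2 + 2k counts the start, the k updates and the k + 1 passages to the second loop. A
uniform bound on partial executions also rules out nontermination. -/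
theorem runningTime_le (h1 : α < 1) (hε : 0 < ε)
    (hupd : ∀ i < k, ∀ S, (∀ x, RowInvariant (E i) α t S x) →
      ∀ x, RowInvariant (E (i + 1)) α t (upd i S) x)
    {w : ℕ → V → ℝ} (hw : ∀ i ≤ k, ∀ x, 0 ≤ w i x)
    (hpush : ∀ i ≤ k, ∀ u,
      (1 + inDeg (E i) u : ℝ) + (1 - α) * ∑ x, w i x * lazyWalk (E i) x u ≤ w i u)
    {δ : ℕ → ℝ} (hδ : ∀ i < k, 0 ≤ δ i)
    (hpot : ∀ i < k, ∀ S, (∀ x, RowInvariant (E i) α t S x) → (∀ x, |S.res x| ≤ ε) →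
      ∑ x, w (i + 1) x * |(upd i S).res x| ≤ ∑ x, w i x * |S.res x| + δ i) :
    runningTime E upd k α ε t ≤
      ENNReal.ofReal (2 + 2 * k + (w 0 t + ∑ i ∈ Finset.range k, δ i) / ε) := by
  refine iSup₂_le fun c hc => ?_
  obtain ⟨i, ph, S, hr⟩ := hc
  have hi := (hr.invariant h1 hε hupd).1
  have h := hr.mul_cost_add_le h1 hε hupd hw hpush hpot
  have hΦ : 0 ≤ ∑ x, w i x * |S.res x| :=
    Finset.sum_nonneg fun x _ => mul_nonneg (hw i hi x) (abs_nonneg _)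
  have hm : ph.cost ≤ 1 := by cases ph <;> norm_num [Phase.cost]
  have hsum : ∑ j ∈ Finset.range i, δ j ≤ ∑ j ∈ Finset.range k, δ j :=
    Finset.sum_le_sum_of_subset_of_nonneg (Finset.range_mono hi)
      fun j hj _ => hδ j (Finset.mem_range.1 hj)
  have hik : (i : ℝ) ≤ k := by exact_mod_cast hi
  rw [← ENNReal.ofReal_natCast]
  refine ENNReal.ofReal_le_ofReal ?_
  have e1 : ε * (1 + 2 * i + ph.cost) ≤ ε * (2 + 2 * k) :=
    mul_le_mul_of_nonneg_left (by linarith) hε.le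
  have e2 : ε * c ≤ ε * (2 + 2 * k) + (w 0 t + ∑ j ∈ Finset.range k, δ j) := by linarith
  rw [← sub_le_iff_le_add', le_div_iff₀ hε]
  linarith

/-- The average of the running times over a set of targets. -/
theorem sum_runningTime_div_le {V : Type*} {T : V → ℝ≥0∞} {b : V → ℝ} {B : ℝ} {V₀ : Finset V}
    (hV₀ : V₀.Nonempty) (hT : ∀ t ∈ V₀, T t ≤ ENNReal.ofReal (b t)) (hb : ∀ t ∈ V₀, 0 ≤ b t)
    (hB : ∑ t ∈ V₀, b t ≤ V₀.card * B) :
    (∑ t ∈ V₀, T t) / (V₀.card : ℝ≥0∞) ≤ ENNReal.ofReal B := by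
  have hc : (0 : ℝ) < V₀.card := by exact_mod_cast hV₀.card_pos
  calc (∑ t ∈ V₀, T t) / (V₀.card : ℝ≥0∞) ≤ ENNReal.ofReal (V₀.card * B) / V₀.card := by
        gcongr
        refine (Finset.sum_le_sum hT).trans ?_
        rw [← ENNReal.ofReal_sum_of_nonneg hb]
        exact ENNReal.ofReal_le_ofReal hB
    _ = ENNReal.ofReal B := by
        rw [← ENNReal.ofReal_natCast, ← ENNReal.ofReal_div_of_pos hc, mul_div_cancel_left₀ _ hc.ne']

end Cost

/-! ### Arbitrary updates of an undirected graph. -/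

section Undirected

variable {V : Type*} [Fintype V]

theorem mem_arcs (G : SimpleGraph V) (x y : V) : (x, y) ∈ arcs G ↔ G.Adj x y := by
  simp [arcs]

variable [DecidableEq V]

theorem inDeg_arcs (G : SimpleGraph V) (x : V) : inDeg (arcs G) x = outDeg (arcs G) x := by
  rw [inDeg_eq_sum, outDeg_eq_sum]
  exact Finset.sum_congr rfl fun y _ =>
    if_congr (by rw [mem_arcs, mem_arcs, G.adj_comm]) rfl rfl

theorem danglingIsolated_undirSeq (G₀ : SimpleGraph V) (e : ℕ → V × V) (i : ℕ) :
    DanglingIsolated (undirSeq G₀ e i) := fun x hx => by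
  rw [undirSeq, inDeg_arcs]
  exact hx

variable {G₀ : SimpleGraph V} {e : ℕ → V × V} {i : ℕ} {α ε : ℝ} {t : V} {S : State V}

theorem mem_undirSeq_succ (he : (e i).1 ≠ (e i).2) (x y : V) :
    (x, y) ∈ undirSeq G₀ e (i + 1) ↔ ((x, y) ∈ undirSeq G₀ e i ↔
      ¬ (x = (e i).1 ∧ y = (e i).2 ∨ x = (e i).2 ∧ y = (e i).1)) := by
  rw [undirSeq, undirSeq, mem_arcs, mem_arcs, graphSeq, symmDiff_def, SimpleGraph.sup_adj,
    SimpleGraph.sdiff_adj, SimpleGraph.sdiff_adj, SimpleGraph.edge_adj]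
  have hxy : x = (e i).1 ∧ y = (e i).2 ∨ x = (e i).2 ∧ y = (e i).1 → x ≠ y := by
    rintro (⟨rfl, rfl⟩ | ⟨rfl, rfl⟩)
    · exact he
    · exact he.symm
  tauto

theorem togglesOut_undirSeq (he : (e i).1 ≠ (e i).2) :
    TogglesOut (undirSeq G₀ e i) (undirSeq G₀ e (i + 1)) (e i).1 (e i).2 := fun y => by
  rw [mem_undirSeq_succ he]
  simp [he]

theorem togglesOut_undirSeq_symm (he : (e i).1 ≠ (e i).2) :
    TogglesOut (undirSeq G₀ e i) (undirSeq G₀ e (i + 1)) (e i).2 (e i).1 := fun y => by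
  rw [mem_undirSeq_succ he]
  simp [he.symm]

theorem mem_undirSeq_succ_of_ne (he : (e i).1 ≠ (e i).2) {x : V} (h1 : x ≠ (e i).1)
    (h2 : x ≠ (e i).2) (y : V) : (x, y) ∈ undirSeq G₀ e (i + 1) ↔ (x, y) ∈ undirSeq G₀ e i := by
  rw [mem_undirSeq_succ he]
  simp [h1, h2]

theorem undirUpdate_est (G₀ : SimpleGraph V) (e : ℕ → V × V) (α : ℝ) (t : V) (i : ℕ)
    (S : State V) : (undirUpdate G₀ e α t i S).est = S.est := by
  rw [undirUpdate, updateEdge_est, updateEdge_est]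

theorem undirUpdate_res_of_ne {x : V} (h1 : x ≠ (e i).1) (h2 : x ≠ (e i).2) :
    (undirUpdate G₀ e α t i S).res x = S.res x := by
  rw [undirUpdate, updateEdge_res_of_ne _ _ _ _ _ h2, updateEdge_res_of_ne _ _ _ _ _ h1]

theorem undirUpdate_res_fst (he : (e i).1 ≠ (e i).2) :
    (undirUpdate G₀ e α t i S).res (e i).1 =
      (updateEdge (undirSeq G₀ e (i + 1)) α t (e i).1 (e i).2 S).res (e i).1 := by
  rw [undirUpdate, updateEdge_res_of_ne _ _ _ _ _ he]

theorem rowInvariant_undirUpdate (h0 : 0 < α) (he : (e i).1 ≠ (e i).2)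
    (hS : ∀ x, RowInvariant (undirSeq G₀ e i) α t S x) (x : V) :
    RowInvariant (undirSeq G₀ e (i + 1)) α t (undirUpdate G₀ e α t i S) x := by
  by_cases hx1 : x = (e i).1
  · rw [hx1]
    refine ((hS _).updateEdge h0 (togglesOut_undirSeq he)).congr (fun _ => Iff.rfl) ?_
      (undirUpdate_res_fst he)
    rw [undirUpdate_est, updateEdge_est]
  · by_cases hx2 : x = (e i).2
    · rw [hx2, undirUpdate]
      refine RowInvariant.updateEdge h0 (togglesOut_undirSeq_symm he) ?_
      exact (hS _).congr (fun _ => Iff.rfl) (updateEdge_est _ _ _ _ _ _)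
        (updateEdge_res_of_ne _ _ _ _ _ he.symm)
    · exact (hS x).congr (mem_undirSeq_succ_of_ne he hx1 hx2) (undirUpdate_est _ _ _ _ _ _)
        (undirUpdate_res_of_ne hx1 hx2)

theorem abs_est_le {E : Finset (V × V)} (hE : DanglingIsolated E) (h0 : 0 < α) (h1 : α < 1)
    (hS : ∀ x, RowInvariant E α t S x) (hR : ∀ x, |S.res x| ≤ ε) (s : V) :
    |S.est s| ≤ ppr E α s t + ε := by
  have e1 := abs_est_sub_ppr_le hE h0 h1 hS hR s
  have e2 := abs_add_le (S.est s - ppr E α s t) (ppr E α s t)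
  rw [sub_add_cancel, abs_of_nonneg (ppr_nonneg E h0 h1 s t)] at e2
  linarith

/-- A bound for the growth of the degree-weighted residuals when an undirected edge changes. -/
noncomputable def undirGrowth (G₀ : SimpleGraph V) (e : ℕ → V × V) (α ε : ℝ) (i : ℕ) (t : V) : ℝ :=
  (2 * ppr (undirSeq G₀ e i) α (e i).1 t + 2 * ppr (undirSeq G₀ e i) α (e i).2 t + 4 * ε +
    (if (e i).1 = t then 1 else 0) + if (e i).2 = t then 1 else 0) / α + 4 * ε

theorem undirGrowth_nonneg (h0 : 0 < α) (h1 : α < 1) (hε : 0 < ε) (i : ℕ) (t : V) :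
    0 ≤ undirGrowth G₀ e α ε i t := by
  have e1 := ppr_nonneg (undirSeq G₀ e i) h0 h1 (e i).1 t
  have e2 := ppr_nonneg (undirSeq G₀ e i) h0 h1 (e i).2 t
  unfold undirGrowth
  positivity

/-- Only here are the targets averaged: the PageRank from a fixed endpoint has total mass at most 1
over all targets, and each endpoint is the target at most once, whence 6 = 2 + 2 + 1 + 1. -/
theorem sum_undirGrowth_le (h0 : 0 < α) (h1 : α < 1) (i : ℕ) (V₀ : Finset V) :
    ∑ t ∈ V₀, undirGrowth G₀ e α ε i t ≤ (6 + 4 * ε * V₀.card) / α + 4 * ε * V₀.card := by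
  have hp : ∀ s, ∑ t ∈ V₀, ppr (undirSeq G₀ e i) α s t ≤ 1 := fun s => by
    rw [← sum_ppr (undirSeq G₀ e i) h0 h1 s]
    exact Finset.sum_le_sum_of_subset_of_nonneg (Finset.subset_univ _)
      fun y _ _ => ppr_nonneg _ h0 h1 s y
  have hi : ∀ s, ∑ t ∈ V₀, (if s = t then (1 : ℝ) else 0) ≤ 1 := fun s => by
    rw [Finset.sum_ite_eq]
    split_ifs <;> norm_num
  have e1 := hp (e i).1
  have e2 := hp (e i).2
  have e3 := hi (e i).1
  have e4 := hi (e i).2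
  unfold undirGrowth
  rw [Finset.sum_add_distrib, ← Finset.sum_div]
  simp only [Finset.sum_add_distrib, ← Finset.mul_sum, Finset.sum_const, nsmul_eq_mul]
  refine add_le_add (div_le_div_of_nonneg_right ?_ h0.le) (le_of_eq (by ring))
  linarith

/-- The two directed steps do not interact: estimates stay fixed and each step changes and reads
only the residual of its own tail. Hence the one-sided bounds add up. -/
theorem sum_max_outDeg_mul_abs_undirUpdate_le (h0 : 0 < α) (h1 : α < 1)
    (he : (e i).1 ≠ (e i).2) (hS : ∀ x, RowInvariant (undirSeq G₀ e i) α t S x)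
    (hR : ∀ x, |S.res x| ≤ ε) :
    ∑ x, max 1 (outDeg (undirSeq G₀ e (i + 1)) x : ℝ) * |(undirUpdate G₀ e α t i S).res x| ≤
      ∑ x, max 1 (outDeg (undirSeq G₀ e i) x : ℝ) * |S.res x| + undirGrowth G₀ e α ε i t := by
  set a := (e i).1 with ha
  set b := (e i).2 with hb
  let g : V → V → ℝ := fun u v =>
    (|S.est v| + |S.est u| + if u = t then 1 else 0) / α + 2 * |S.res u|
  have hx : ∀ x, max 1 (outDeg (undirSeq G₀ e (i + 1)) x : ℝ) *
      |(undirUpdate G₀ e α t i S).res x| ≤ max 1 (outDeg (undirSeq G₀ e i) x : ℝ) * |S.res x| +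
        ((if x = a then g a b else 0) + if x = b then g b a else 0) := by
    intro x
    by_cases hxa : x = a
    · have hxb : x ≠ b := hxa ▸ he
      rw [if_pos hxa, if_neg hxb, add_zero, hxa, ha, undirUpdate_res_fst he]
      exact max_outDeg_mul_abs_updateEdge_res_le h0 h1 (togglesOut_undirSeq he)
    · by_cases hxb : x = b
      · rw [if_neg hxa, if_pos hxb, zero_add, hxb, hb, undirUpdate]
        have := max_outDeg_mul_abs_updateEdge_res_le (t := t) (S := updateEdge
          (undirSeq G₀ e (i + 1)) α t (e i).1 (e i).2 S) h0 h1
          (togglesOut_undirSeq_symm (G₀ := G₀) he)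
        rw [updateEdge_est, updateEdge_res_of_ne _ _ _ _ S he.symm] at this
        exact this
      · rw [if_neg hxa, if_neg hxb, undirUpdate_res_of_ne hxa hxb,
          outDeg_congr (mem_undirSeq_succ_of_ne he hxa hxb)]
        simp
  have hsum := Finset.sum_le_sum fun x (_ : x ∈ Finset.univ) => hx x
  rw [Finset.sum_add_distrib, Finset.sum_add_distrib] at hsum
  simp only [Finset.sum_ite_eq', Finset.mem_univ, if_true] at hsum
  refine hsum.trans (add_le_add le_rfl ?_)
  have hE := danglingIsolated_undirSeq G₀ e i
  have pa := abs_est_le hE h0 h1 hS hR a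
  have pb := abs_est_le hE h0 h1 hS hR b
  have hab : g a b + g b a = (2 * |S.est a| + 2 * |S.est b| + (if a = t then 1 else 0) +
      if b = t then 1 else 0) / α + (2 * |S.res a| + 2 * |S.res b|) := by
    simp only [g]
    ring
  rw [hab, undirGrowth]
  refine add_le_add (div_le_div_of_nonneg_right ?_ h0.le) (by linarith [hR a, hR b])
  linarith

/-- With D = max(1, deg u), the factor 1 - α takes 2D off the weight (2/α)D, and 2D ≥ 1 + deg u is
the cost of a push. -/
theorem runningTime_undirSeq_le {k : ℕ} (h0 : 0 < α) (h1 : α < 1) (hε : 0 < ε)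
    (he : ∀ i < k, (e i).1 ≠ (e i).2) (t : V) :
    runningTime (undirSeq G₀ e) (undirUpdate G₀ e α t) k α ε t ≤
      ENNReal.ofReal (2 + 2 * k + (2 / α * max 1 (outDeg (undirSeq G₀ e 0) t : ℝ) +
        ∑ i ∈ Finset.range k, 2 / α * undirGrowth G₀ e α ε i t) / ε) := by
  refine runningTime_le (w := fun i x => 2 / α * max 1 (outDeg (undirSeq G₀ e i) x : ℝ)) h1 hε
    (fun i hi S hS => rowInvariant_undirUpdate h0 (he i hi) hS) (fun _ _ _ => by positivity) ?_
    (fun i _ => mul_nonneg (by positivity) (undirGrowth_nonneg h0 h1 hε i t)) ?_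
  · intro i _ u
    have hd : inDeg (undirSeq G₀ e i) u = outDeg (undirSeq G₀ e i) u := inDeg_arcs _ u
    have hmax : (outDeg (undirSeq G₀ e i) u : ℝ) + (if outDeg (undirSeq G₀ e i) u = 0 then 1 else 0)
        = max 1 (outDeg (undirSeq G₀ e i) u : ℝ) := by
      split_ifs with h
      · simp [h]
      · rw [add_zero, max_eq_right]
        exact_mod_cast Nat.one_le_iff_ne_zero.2 h
    simp only [mul_assoc]
    rw [← Finset.mul_sum, sum_max_outDeg_mul_lazyWalk, hd, hmax]
    have e1 : (1 : ℝ) ≤ max 1 (outDeg (undirSeq G₀ e i) u : ℝ) := le_max_left _ _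
    have e2 : (outDeg (undirSeq G₀ e i) u : ℝ) ≤ max 1 (outDeg (undirSeq G₀ e i) u : ℝ) :=
      le_max_right _ _
    have e3 : (1 - α) * (2 / α * max 1 (outDeg (undirSeq G₀ e i) u : ℝ)) =
        2 / α * max 1 (outDeg (undirSeq G₀ e i) u : ℝ) -
          2 * max 1 (outDeg (undirSeq G₀ e i) u : ℝ) := by
      field_simp
    linarith
  · intro i hi S hS hR
    simp only [mul_assoc]
    rw [← Finset.mul_sum, ← Finset.mul_sum, ← mul_add]
    exact mul_le_mul_of_nonneg_left (sum_max_outDeg_mul_abs_undirUpdate_le h0 h1 (he i hi) hS hR)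
      (by positivity)

theorem accurate_undirSeq {k : ℕ} (h0 : 0 < α) (h1 : α < 1) (hε : 0 < ε)
    (he : ∀ i < k, (e i).1 ≠ (e i).2) (t : V) :
    Accurate (undirSeq G₀ e) (undirUpdate G₀ e α t) k α ε t :=
  accurate_of_rowInvariant h0 h1 hε (fun i _ => danglingIsolated_undirSeq G₀ e i)
    fun i hi _ hS => rowInvariant_undirUpdate h0 (he i hi) hS

theorem average_runningTime_undirSeq_le {k : ℕ} {V₀ : Finset V} (h0 : 0 < α) (h1 : α < 1)
    (hε : 0 < ε) (hε1 : ε < 1) (hV₀ : V₀.Nonempty) (hG₀ : ∀ x, x ∈ V₀ ↔ ∃ y, G₀.Adj x y)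
    (he : ∀ i < k, (e i).1 ≠ (e i).2) :
    (∑ t ∈ V₀, runningTime (undirSeq G₀ e) (undirUpdate G₀ e α t) k α ε t) /
        (V₀.card : ℝ≥0∞) ≤
      ENNReal.ofReal (20 * (k / α ^ 2 + k / (V₀.card * ε * α ^ 2) +
        ((∑ x ∈ V₀, (outDeg (arcs G₀) x : ℝ)) / V₀.card) / (α * ε))) := by
  refine sum_runningTime_div_le hV₀ (fun t _ => runningTime_undirSeq_le h0 h1 hε he t)
    (fun t _ => ?_) ?_
  · have := Finset.sum_nonneg fun i (_ : i ∈ Finset.range k) =>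
      undirGrowth_nonneg (G₀ := G₀) (e := e) h0 h1 hε i t
    rw [← Finset.mul_sum]
    positivity
  · set n : ℝ := (V₀.card : ℝ) with hn
    set D : ℝ := ∑ x ∈ V₀, (outDeg (arcs G₀) x : ℝ) with hD
    have hn0 : 0 < n := by rw [hn]; exact_mod_cast hV₀.card_pos
    have hdeg : ∀ x ∈ V₀, (1 : ℝ) ≤ outDeg (arcs G₀) x := by
      intro x hx
      obtain ⟨y, hy⟩ := (hG₀ x).1 hx
      exact_mod_cast Nat.one_le_iff_ne_zero.2 (outDeg_ne_zero_of_mem ((mem_arcs G₀ x y).2 hy))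
    have hnD : n ≤ D := by
      have := Finset.sum_le_sum hdeg
      simpa [hn, hD] using this
    have hmax : ∑ t ∈ V₀, max 1 (outDeg (undirSeq G₀ e 0) t : ℝ) = D :=
      Finset.sum_congr rfl fun t ht => max_eq_right (hdeg t ht)
    have hg : ∑ t ∈ V₀, ∑ i ∈ Finset.range k, 2 / α * undirGrowth G₀ e α ε i t ≤
        k * (2 / α * ((6 + 4 * ε * n) / α + 4 * ε * n)) := by
      rw [Finset.sum_comm]
      refine (Finset.sum_le_card_nsmul _ _ (2 / α * ((6 + 4 * ε * n) / α + 4 * ε * n))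
        fun i _ => ?_).trans (le_of_eq (by simp))
      rw [← Finset.mul_sum]
      exact mul_le_mul_of_nonneg_left (sum_undirGrowth_le h0 h1 i V₀) (by positivity)
    -- The constant is made opaque so that distributing the sum over targets does not split it.
    obtain ⟨L, hL⟩ : ∃ L : ℝ, L = 2 + 2 * k := ⟨_, rfl⟩
    simp only [← hL]
    rw [Finset.sum_add_distrib, ← Finset.sum_div, Finset.sum_add_distrib, ← Finset.mul_sum, hmax,
      Finset.sum_const, nsmul_eq_mul, ← hn]
    have hdiv : (2 / α * D + ∑ t ∈ V₀, ∑ i ∈ Finset.range k, 2 / α * undirGrowth G₀ e α ε i t) / ε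
        ≤ (2 / α * D + k * (2 / α * ((6 + 4 * ε * n) / α + 4 * ε * n))) / ε := by
      gcongr
    have e1 : (2 / α * D + k * (2 / α * ((6 + 4 * ε * n) / α + 4 * ε * n))) / ε =
        2 * (D / (α * ε)) + 12 * (k / (ε * α ^ 2)) + 8 * (k * n / α ^ 2) + 8 * (k * n / α) := by
      field_simp
      ring
    have e2 : n * (20 * (k / α ^ 2 + k / (n * ε * α ^ 2) + D / n / (α * ε))) =
        20 * (k * n / α ^ 2) + 20 * (k / (ε * α ^ 2)) + 20 * (D / (α * ε)) := by
      field_simp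
    have e3 : n ≤ D / (α * ε) := by
      rw [le_div_iff₀ (by positivity)]
      have : α * ε ≤ 1 := by nlinarith
      nlinarith
    have e4 : k * n / α ≤ k * n / α ^ 2 := by
      gcongr
      nlinarith
    have e5 : k * n ≤ k * n / α := by
      rw [le_div_iff₀ h0]
      have : 0 ≤ (k : ℝ) * n := by positivity
      nlinarith
    have e6 : 0 ≤ k / (ε * α ^ 2) := by positivity
    have e7 : 0 ≤ k * n := by positivity
    rw [e2, hL]
    linarith

end Undirected

/-! ### The PageRank weight of a directed graph and its change under insertion. -/

section Weight

variable {V : Type*} [DecidableEq V] [Fintype V] {E : Finset (V × V)} {α ε : ℝ}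

/-- The expected cost, up to constants, that is caused by a unit of residual at `x`. -/
noncomputable def pprWeight (E : Finset (V × V)) (α : ℝ) (x : V) : ℝ :=
  (∑ u, (1 + inDeg E u : ℝ) * ppr E α u x) / α

theorem pprWeight_nonneg (E : Finset (V × V)) (h0 : 0 < α) (h1 : α < 1) (x : V) :
    0 ≤ pprWeight E α x :=
  div_nonneg (Finset.sum_nonneg fun u _ => mul_nonneg (by positivity) (ppr_nonneg E h0 h1 u x))
    h0.le

theorem sum_pprWeight (E : Finset (V × V)) (h0 : 0 < α) (h1 : α < 1) :
    ∑ x, pprWeight E α x = (Fintype.card V + E.card) / α := by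
  unfold pprWeight
  rw [← Finset.sum_div, Finset.sum_comm]
  congr 1
  rw [Finset.sum_congr rfl fun u _ => by rw [← Finset.mul_sum, sum_ppr E h0 h1, mul_one],
    Finset.sum_add_distrib, ← sum_inDeg E]
  simp

/-- This superposes the PageRank equations of all sources u with coefficients (1 + d^in(u))/α. It is
the weight condition of the potential with equality. -/
theorem pprWeight_eq (hE : DanglingIsolated E) (h0 : 0 < α) (h1 : α < 1) (x : V) :
    pprWeight E α x =
      (1 + inDeg E x : ℝ) + (1 - α) * ∑ z, pprWeight E α z * lazyWalk E z x := by
  have hu : ∀ u, (1 + inDeg E u : ℝ) * ppr E α u x =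
      (if x = u then α * (1 + inDeg E x : ℝ) else 0) +
        (1 - α) * ∑ z, (1 + inDeg E u : ℝ) * ppr E α u z * lazyWalk E z x := by
    intro u
    conv_lhs => rw [ppr_eq_lazy hE h0 h1 u x]
    simp only [mul_assoc]
    rw [← Finset.mul_sum]
    split_ifs with h
    · subst h
      ring
    · ring
  have hz : ∑ u, ∑ z, (1 + inDeg E u : ℝ) * ppr E α u z * lazyWalk E z x =
      α * ∑ z, pprWeight E α z * lazyWalk E z x := by
    rw [Finset.sum_comm, Finset.mul_sum]
    refine Finset.sum_congr rfl fun z _ => ?_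
    rw [← Finset.sum_mul, pprWeight]
    field_simp
  conv_lhs => rw [pprWeight]
  rw [Finset.sum_congr rfl fun u _ => hu u, Finset.sum_add_distrib, ← Finset.mul_sum, hz]
  simp only [Finset.sum_ite_eq, Finset.mem_univ, if_true]
  field_simp

theorem inDeg_insert {V : Type*} [DecidableEq V] {E : Finset (V × V)} {u v : V}
    (h : (u, v) ∉ E) (y : V) :
    inDeg (insert (u, v) E) y = inDeg E y + if y = v then 1 else 0 := by
  unfold inDeg
  rw [Finset.filter_insert]
  by_cases hy : y = v
  · subst hy
    simp [h]
  · simp [hy, Ne.symm hy]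

/-- Inserting an edge at `u` changes the weights little if `u` has a small weight per out-edge. -/
theorem sum_abs_pprWeight_insert_sub_le {u v : V} (huv : (u, v) ∉ E) (hE : DanglingIsolated E)
    (hE' : DanglingIsolated (insert (u, v) E)) (h0 : 0 < α) (h1 : α < 1) :
    ∑ x, |pprWeight (insert (u, v) E) α x - pprWeight E α x| ≤
      (1 + 2 * (pprWeight (insert (u, v) E) α u / outDeg (insert (u, v) E) u)) / α := by
  set E' := insert (u, v) E with hEE'
  set w' := pprWeight E' α with hw'
  set w := pprWeight E α with hw
  have hm : ∀ y, (u, y) ∈ E' ↔ (u, y) ∈ E ∨ y = v := fun y => by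
    rw [hEE', Finset.mem_insert, Prod.mk.injEq]
    tauto
  have hK : ∀ y, ∑ x, w' x * lazyWalk E' x y = ∑ x, w' x * lazyWalk E x y +
      w' u * (((if y = v then 1 else 0) - lazyWalk E u y) / (outDeg E' u : ℝ)) := by
    intro y
    have : ∀ x, w' x * lazyWalk E' x y = w' x * lazyWalk E x y + if x = u then
        w' u * (((if y = v then 1 else 0) - lazyWalk E u y) / (outDeg E' u : ℝ)) else 0 := by
      intro x
      by_cases hx : x = u
      · subst hx
        rw [lazyWalk_insert hm huv, if_pos rfl, mul_add]
      · rw [if_neg hx, add_zero, lazyWalk_congr (E := E)]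
        intro z
        simp [hEE', hx]
    rw [Finset.sum_congr rfl fun x _ => this x, Finset.sum_add_distrib]
    simp
  -- The difference of the weights solves the equation of the old walk, with a source from the new
  -- in-degree and from row u, the only row that changed. The ℓ¹ contraction then applies.
  have heq : ∀ y, w' y - w y = ((if y = v then 1 else 0) + (1 - α) * (w' u / outDeg E' u) *
      ((if y = v then 1 else 0) - lazyWalk E u y)) +
        (1 - α) * ∑ x, (w' x - w x) * lazyWalk E x y := by
    intro y
    have e1 := pprWeight_eq hE' h0 h1 y
    have e2 := pprWeight_eq hE h0 h1 y
    rw [← hw', hK, inDeg_insert huv] at e1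
    rw [← hw] at e2
    have e3 : ∑ x, (w' x - w x) * lazyWalk E x y =
        ∑ x, w' x * lazyWalk E x y - ∑ x, w x * lazyWalk E x y := by
      rw [← Finset.sum_sub_distrib]
      exact Finset.sum_congr rfl fun x _ => by ring
    rw [e3]
    push_cast at e1
    linear_combination e1 - e2
  have h := sum_abs_le_of_eq_add h1 (lazyWalk_nonneg E) (sum_lazyWalk E) heq
  have hq : 0 ≤ w' u / outDeg E' u :=
    div_nonneg (pprWeight_nonneg E' h0 h1 u) (Nat.cast_nonneg _)
  rw [le_div_iff₀ h0, mul_comm]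
  refine h.trans ?_
  have hy : ∀ y, |(if y = v then (1 : ℝ) else 0) + (1 - α) * (w' u / outDeg E' u) *
      ((if y = v then 1 else 0) - lazyWalk E u y)| ≤ (if y = v then 1 else 0) +
        (w' u / outDeg E' u) * ((if y = v then 1 else 0) + lazyWalk E u y) := by
    intro y
    have hi : (0 : ℝ) ≤ if y = v then 1 else 0 := by split_ifs <;> norm_num
    have hk := lazyWalk_nonneg E u y
    refine (abs_add_le _ _).trans (add_le_add (abs_of_nonneg hi).le ?_)
    rw [abs_mul, abs_mul, abs_of_nonneg (by linarith : 0 ≤ 1 - α), abs_of_nonneg hq]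
    have e1 := abs_sub (if y = v then (1 : ℝ) else 0) (lazyWalk E u y)
    rw [abs_of_nonneg hi, abs_of_nonneg hk] at e1
    refine mul_le_mul ?_ e1 (abs_nonneg _) hq
    nlinarith
  refine (Finset.sum_le_sum fun y _ => hy y).trans (le_of_eq ?_)
  rw [Finset.sum_add_distrib, ← Finset.mul_sum, Finset.sum_add_distrib, sum_lazyWalk]
  simp
  ring

/-- Two effects are charged: the change of the weights, on residuals of size at most ε, and the
correction at u, whose weight is q times the new degree, so that the degree cancels again. -/
theorem sum_pprWeight_mul_abs_updateEdge_le {t u v : V} {S : State V} (huv : (u, v) ∉ E)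
    (hE : DanglingIsolated E) (hE' : DanglingIsolated (insert (u, v) E)) (h0 : 0 < α)
    (h1 : α < 1) (hε : 0 < ε) (hS : ∀ x, RowInvariant E α t S x) (hR : ∀ x, |S.res x| ≤ ε)
    {q : ℝ} (hq : q = pprWeight (insert (u, v) E) α u / outDeg (insert (u, v) E) u) :
    ∑ x, pprWeight (insert (u, v) E) α x *
        |(updateEdge (insert (u, v) E) α t u v S).res x| ≤
      ∑ x, pprWeight E α x * |S.res x| + (ε * ((1 + 2 * q) / α) +
        q * ((ppr E α v t + ppr E α u t + 2 * ε + if u = t then 1 else 0) / α + ε)) := by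
  have hd := sum_abs_pprWeight_insert_sub_le huv hE hE' h0 h1
  rw [← hq] at hd
  set E' := insert (u, v) E with hEE'
  have hm : (u, v) ∈ E' := Finset.mem_insert_self _ _
  have hx : ∀ x, pprWeight E' α x * |(updateEdge E' α t u v S).res x| ≤
      pprWeight E α x * |S.res x| + ε * |pprWeight E' α x - pprWeight E α x| +
        if x = u then pprWeight E' α u * |correction E' α t u v S| else 0 := by
    intro x
    have hw := pprWeight_nonneg E' h0 h1 x
    have e1 : pprWeight E' α x * |S.res x| ≤
        pprWeight E α x * |S.res x| + ε * |pprWeight E' α x - pprWeight E α x| := by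
      have := mul_le_mul (le_abs_self (pprWeight E' α x - pprWeight E α x)) (hR x)
        (abs_nonneg _) (abs_nonneg _)
      linarith
    by_cases hxu : x = u
    · subst hxu
      simp only [updateEdge, hm, if_true, insertEdge, Function.update_self]
      have := mul_le_mul_of_nonneg_left
        (abs_add_le (S.res x) (correction E' α t x v S)) hw
      linarith
    · rw [updateEdge_res_of_ne _ _ _ _ _ hxu, if_neg hxu, add_zero]
      exact e1
  have hsum := Finset.sum_le_sum fun x (_ : x ∈ Finset.univ) => hx x
  rw [Finset.sum_add_distrib, Finset.sum_add_distrib, ← Finset.mul_sum] at hsum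
  simp only [Finset.sum_ite_eq', Finset.mem_univ, if_true] at hsum
  have hdeg : (outDeg E' u : ℝ) ≠ 0 := by exact_mod_cast outDeg_ne_zero_of_mem hm
  have hq0 : 0 ≤ q := hq ▸ div_nonneg (pprWeight_nonneg E' h0 h1 u) (Nat.cast_nonneg _)
  have hc : pprWeight E' α u * |correction E' α t u v S| ≤
      q * ((ppr E α v t + ppr E α u t + 2 * ε + if u = t then 1 else 0) / α + ε) := by
    have : pprWeight E' α u = q * outDeg E' u := by rw [hq]; field_simp
    rw [this, mul_assoc]
    refine mul_le_mul_of_nonneg_left ?_ hq0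
    refine (outDeg_mul_abs_correction_le E' h0 h1 t u v S).trans ?_
    refine add_le_add (div_le_div_of_nonneg_right ?_ h0.le) (hR u)
    linarith [abs_est_le hE h0 h1 hS hR u, abs_est_le hE h0 h1 hS hR v]
  have := mul_le_mul_of_nonneg_left hd hε.le
  linarith

theorem NoDangling.card_le (hE : NoDangling E) : Fintype.card V ≤ E.card := by
  rw [← sum_outDeg E]
  simpa using Finset.card_nsmul_le_sum Finset.univ (outDeg E) 1 fun x _ => (hE x).2

/-- The expectation of the weight per out-edge of the tail of a uniformly random edge. -/
theorem sum_edges_pprWeight_div_outDeg_le (hE : NoDangling E) (h0 : 0 < α) (h1 : α < 1) :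
    ∑ e ∈ E, pprWeight E α e.1 / outDeg E e.1 ≤ E.card * (2 / α) := by
  -- Each tail x occurs once per out-edge, which cancels the division by its out-degree.
  have hfib : ∑ e ∈ E, pprWeight E α e.1 / outDeg E e.1 = ∑ x, pprWeight E α x := by
    rw [← Finset.sum_fiberwise_of_maps_to (g := Prod.fst) (t := Finset.univ) (by simp)]
    refine Finset.sum_congr rfl fun x _ => ?_
    rw [Finset.sum_congr rfl (g := fun _ => pprWeight E α x / outDeg E x)
      fun e he => by rw [(Finset.mem_filter.1 he).2], Finset.sum_const, nsmul_eq_mul]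
    have : (outDeg E x : ℝ) ≠ 0 := by exact_mod_cast (hE x).2.ne'
    change (outDeg E x : ℝ) * _ = _
    field_simp
  have hn : (Fintype.card V : ℝ) ≤ E.card := by exact_mod_cast hE.card_le
  rw [hfib, sum_pprWeight E h0 h1, ← mul_div_assoc]
  exact div_le_div_of_nonneg_right (by linarith) h0.le

end Weight

/-! ### Random edge order. -/

section Directed

variable {V : Type*} [DecidableEq V] {E : Finset (V × V)} {m k : ℕ}

theorem permSeq_trans (τ : Fin (m + k) ≃ Fin (m + k)) (σ : Fin (m + k) ≃ E) {i : ℕ}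
    (hτ : ∀ j, (τ j : ℕ) < m + i ↔ (j : ℕ) < m + i) : permSeq (τ.trans σ) i = permSeq σ i := by
  ext e
  simp only [permSeq, Finset.mem_image, Finset.mem_filter, Finset.mem_univ, true_and,
    Equiv.trans_apply]
  constructor
  · rintro ⟨j, hj, rfl⟩
    exact ⟨τ j, (hτ j).2 hj, rfl⟩
  · rintro ⟨j, hj, rfl⟩
    exact ⟨τ.symm j, (hτ _).1 (by simpa using hj), by simp⟩

theorem sum_permSeq (σ : Fin (m + k) ≃ E) (i : ℕ) (f : V × V → ℝ) :
    ∑ e ∈ permSeq σ i, f e =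
      ∑ j ∈ Finset.univ.filter (fun j : Fin (m + k) => (j : ℕ) < m + i), f (σ j) :=
  Finset.sum_image fun _ _ _ _ h => σ.injective (Subtype.ext h)

theorem card_filter_val_lt {i : ℕ} (hi : i ≤ k) :
    (Finset.univ.filter (fun j : Fin (m + k) => (j : ℕ) < m + i)).card = m + i := by
  rw [Fin.card_filter_val_lt]
  omega

theorem card_permSeq (σ : Fin (m + k) ≃ E) {i : ℕ} (hi : i ≤ k) :
    (permSeq σ i).card = m + i := by
  unfold permSeq
  rw [Finset.card_image_of_injective _ fun _ _ h => σ.injective (Subtype.ext h),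
    card_filter_val_lt hi]

theorem permSeq_succ (σ : Fin (m + k) ≃ E) {i : ℕ} (hi : i < k) :
    permSeq σ (i + 1) = insert (σ ⟨m + i, by omega⟩ : V × V) (permSeq σ i) := by
  unfold permSeq
  rw [← Finset.image_insert (fun j => (σ j : V × V))]
  congr 1
  ext j
  simp only [Finset.mem_filter, Finset.mem_univ, true_and, Finset.mem_insert, Fin.ext_iff]
  omega

theorem last_notMem_permSeq (σ : Fin (m + k) ≃ E) {i : ℕ} (hi : i < k) :
    (σ ⟨m + i, by omega⟩ : V × V) ∉ permSeq σ i := by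
  simp only [permSeq, Finset.mem_image, Finset.mem_filter, Finset.mem_univ, true_and, not_exists,
    not_and]
  intro j hj h
  have := σ.injective (Subtype.ext h)
  subst this
  simp at hj

theorem NoDangling.mono {E' : Finset (V × V)} (h : NoDangling E) (hE : E ⊆ E') :
    NoDangling E' := fun x =>
  ⟨(h x).1.trans_le (Finset.card_le_card (Finset.filter_subset_filter _ hE)),
    (h x).2.trans_le (Finset.card_le_card (Finset.filter_subset_filter _ hE))⟩

theorem permSeq_mono (σ : Fin (m + k) ≃ E) : Monotone (permSeq σ) := fun i j hij =>
  Finset.image_subset_image fun x hx => by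
    simp only [Finset.mem_filter, Finset.mem_univ, true_and] at hx ⊢
    omega

/-- Given the set of the first `m + i + 1` edges of a random ordering, the last of them is uniformly
distributed. -/
theorem sum_last_edge_mul {i : ℕ} (hi : i < k) (f : Finset (V × V) → V × V → ℝ) :
    (∑ σ : Fin (m + k) ≃ E, f (permSeq σ (i + 1)) (σ ⟨m + i, by omega⟩)) * (m + i + 1 : ℕ) =
      ∑ σ : Fin (m + k) ≃ E, ∑ e ∈ permSeq σ (i + 1), f (permSeq σ (i + 1)) e := by
  simp only [sum_permSeq]
  symm
  rw [Finset.sum_comm]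
  refine (Finset.sum_congr rfl (g := fun _ =>
    ∑ σ : Fin (m + k) ≃ E, f (permSeq σ (i + 1)) (σ ⟨m + i, by omega⟩)) ?_).trans ?_
  · intro j hj
    rw [Finset.mem_filter] at hj
    set l : Fin (m + k) := ⟨m + i, by omega⟩ with hl
    -- Exchanging position j with the last position of the prefix is a bijection of orderings that
    -- preserves the set of the first m + i + 1 edges, so every position contributes equally.
    refine Fintype.sum_equiv ((Equiv.swap j l).equivCongr (Equiv.refl E)) _ _ fun σ => ?_
    have : (Equiv.swap j l).equivCongr (Equiv.refl E) σ = (Equiv.swap j l).trans σ := by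
      refine Equiv.ext fun x => ?_
      simp [Equiv.equivCongr]
    rw [this, permSeq_trans]
    · simp
    · intro x
      by_cases h1 : x = j
      · subst h1
        simp only [Equiv.swap_apply_left, hj.2, iff_true, hl]
        omega
      · by_cases h2 : x = l
        · rw [h2, Equiv.swap_apply_right]
          simp only [hj.2, true_iff, hl]
          omega
        · rw [Equiv.swap_apply_of_ne_of_ne h1 h2]
  · rw [Finset.sum_const, card_filter_val_lt hi, nsmul_eq_mul, mul_comm]
    rfl

theorem permUpdate_eq (σ : Fin (m + k) ≃ E) (α : ℝ) (t : V) {i : ℕ} (hi : i < k)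
    (S : State V) {u v : V} (huv : (σ ⟨m + i, by omega⟩ : V × V) = (u, v)) :
    permUpdate σ α t i S = updateEdge (insert (u, v) (permSeq σ i)) α t u v S := by
  simp only [permUpdate, hi, dif_pos, permSeq_succ σ hi, huv]

variable [Fintype V] {α ε : ℝ}

/-- The weight per out-edge at the tail of the edge inserted last into `permSeq σ (i + 1)`. -/
noncomputable def lastEdgeLoad (α : ℝ) (σ : Fin (m + k) ≃ E) (i : ℕ) : ℝ :=
  if h : i < k then
    if NoDangling (permSeq σ (i + 1)) then
      pprWeight (permSeq σ (i + 1)) α (σ ⟨m + i, by omega⟩ : V × V).1 /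
        outDeg (permSeq σ (i + 1)) (σ ⟨m + i, by omega⟩ : V × V).1
    else 0
  else 0

theorem lastEdgeLoad_nonneg (h0 : 0 < α) (h1 : α < 1) (σ : Fin (m + k) ≃ E) (i : ℕ) :
    0 ≤ lastEdgeLoad α σ i := by
  unfold lastEdgeLoad
  split_ifs
  · exact div_nonneg (pprWeight_nonneg _ h0 h1 _) (Nat.cast_nonneg _)
  · exact le_rfl
  · exact le_rfl

/-- This is the backward analysis. The event A depends on more than the set of the first m + i + 1
edges, so the load is cut off by the weaker event that this prefix has no dangling vertex; the
cut-off is then constant when averaging over the last edge. -/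
theorem sum_lastEdgeLoad_le (h0 : 0 < α) (h1 : α < 1) (hE : E.card = m + k) {i : ℕ}
    (hi : i < k) :
    ∑ σ : Fin (m + k) ≃ E, lastEdgeLoad α σ i ≤ (m + k).factorial * (2 / α) := by
  have h := sum_last_edge_mul (m := m) (E := E) hi fun F e =>
    if NoDangling F then pprWeight F α e.1 / outDeg F e.1 else 0
  have hb : ∀ σ : Fin (m + k) ≃ E, (∑ e ∈ permSeq σ (i + 1), if NoDangling (permSeq σ (i + 1))
      then pprWeight (permSeq σ (i + 1)) α e.1 / outDeg (permSeq σ (i + 1)) e.1 else 0) ≤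
        (m + i + 1 : ℕ) * (2 / α) := by
    intro σ
    split_ifs with hF
    · have := sum_edges_pprWeight_div_outDeg_le hF h0 h1
      rwa [card_permSeq σ hi] at this
    · simp only [Finset.sum_const_zero]
      positivity
  have hcard : Fintype.card (Fin (m + k) ≃ E) = (m + k).factorial := by
    rw [Fintype.card_equiv (Fintype.equivOfCardEq (by simp [hE])), Fintype.card_fin]
  have hs := Finset.sum_le_sum fun σ (_ : σ ∈ Finset.univ) => hb σ
  rw [← h, Finset.sum_const, Finset.card_univ, hcard, nsmul_eq_mul, mul_left_comm, mul_comm,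
    mul_le_mul_iff_right₀ (by positivity)] at hs
  simpa only [lastEdgeLoad, hi, dif_pos] using hs

theorem rowInvariant_permUpdate {σ : Fin (m + k) ≃ E} {t : V} {S : State V} {i : ℕ}
    (h0 : 0 < α) (hi : i < k) (hS : ∀ x, RowInvariant (permSeq σ i) α t S x) (x : V) :
    RowInvariant (permSeq σ (i + 1)) α t (permUpdate σ α t i S) x := by
  obtain ⟨⟨u, v⟩, huv⟩ : ∃ e : V × V, (σ ⟨m + i, by omega⟩ : V × V) = e := ⟨_, rfl⟩
  have hn := last_notMem_permSeq σ hi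
  rw [permUpdate_eq σ α t hi S huv, permSeq_succ σ hi]
  rw [huv] at hn ⊢
  by_cases hx : x = u
  · subst hx
    refine (hS x).updateEdge h0 fun y => ?_
    rw [Finset.mem_insert, Prod.mk.injEq]
    by_cases hy : y = v
    · subst hy
      simp [hn]
    · simp [hy]
  · refine (hS x).congr (fun y => by simp [hx]) (updateEdge_est _ _ _ _ _ _)
      (updateEdge_res_of_ne _ _ _ _ _ hx)

theorem accurate_permSeq {σ : Fin (m + k) ≃ E} (h0 : 0 < α) (h1 : α < 1) (hε : 0 < ε)
    (hσ : NoDangling (permSeq σ 0)) (t : V) :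
    Accurate (permSeq σ) (permUpdate σ α t) k α ε t :=
  accurate_of_rowInvariant h0 h1 hε
    (fun i _ => (hσ.mono (permSeq_mono σ i.zero_le)).danglingIsolated)
    fun _ hi _ hS => rowInvariant_permUpdate h0 hi hS

/-- A bound for the growth of the weighted residuals when the next edge is inserted. -/
noncomputable def permGrowth (α ε : ℝ) (σ : Fin (m + k) ≃ E) (i : ℕ) (t : V) : ℝ :=
  if h : i < k then
    ε * ((1 + 2 * lastEdgeLoad α σ i) / α) + lastEdgeLoad α σ i *
      ((ppr (permSeq σ i) α (σ ⟨m + i, by omega⟩ : V × V).2 t +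
        ppr (permSeq σ i) α (σ ⟨m + i, by omega⟩ : V × V).1 t + 2 * ε +
        if (σ ⟨m + i, by omega⟩ : V × V).1 = t then 1 else 0) / α + ε)
  else 0

theorem permGrowth_nonneg (h0 : 0 < α) (h1 : α < 1) (hε : 0 < ε) (σ : Fin (m + k) ≃ E) (i : ℕ)
    (t : V) : 0 ≤ permGrowth α ε σ i t := by
  unfold permGrowth
  split_ifs with h
  all_goals first
    | exact le_rfl
    | have e1 := ppr_nonneg (permSeq σ i) h0 h1 (σ ⟨m + i, by omega⟩ : V × V).1 t
      have e2 := ppr_nonneg (permSeq σ i) h0 h1 (σ ⟨m + i, by omega⟩ : V × V).2 t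
      have e3 := lastEdgeLoad_nonneg h0 h1 σ i
      positivity

/-- The sum over targets turns both PageRank vectors and the indicator into 1 each, whence the 3. -/
theorem sum_permGrowth (h0 : 0 < α) (h1 : α < 1) (σ : Fin (m + k) ≃ E) {i : ℕ} (hi : i < k) :
    ∑ t, permGrowth α ε σ i t = Fintype.card V * (ε * ((1 + 2 * lastEdgeLoad α σ i) / α)) +
      lastEdgeLoad α σ i *
        ((3 + 2 * ε * Fintype.card V) / α + ε * Fintype.card V) := by
  simp only [permGrowth, hi, dif_pos]
  rw [Finset.sum_add_distrib, Finset.sum_const, ← Finset.mul_sum, Finset.sum_add_distrib,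
    ← Finset.sum_div]
  simp only [Finset.sum_add_distrib, sum_ppr _ h0 h1, Finset.sum_const, nsmul_eq_mul,
    Finset.sum_ite_eq, Finset.mem_univ, if_true, Finset.card_univ]
  ring

theorem runningTime_permSeq_le {σ : Fin (m + k) ≃ E} (h0 : 0 < α) (h1 : α < 1) (hε : 0 < ε)
    (hσ : NoDangling (permSeq σ 0)) (t : V) :
    runningTime (permSeq σ) (permUpdate σ α t) k α ε t ≤
      ENNReal.ofReal (2 + 2 * k + (pprWeight (permSeq σ 0) α t +
        ∑ i ∈ Finset.range k, permGrowth α ε σ i t) / ε) := by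
  have hND : ∀ i, NoDangling (permSeq σ i) := fun i => hσ.mono (permSeq_mono σ i.zero_le)
  refine runningTime_le (w := fun i x => pprWeight (permSeq σ i) α x) h1 hε
    (fun i hi S hS => rowInvariant_permUpdate h0 hi hS) (fun _ _ _ => pprWeight_nonneg _ h0 h1 _)
    (fun i _ u => (pprWeight_eq (hND i).danglingIsolated h0 h1 u).ge)
    (fun i _ => permGrowth_nonneg h0 h1 hε σ i t) ?_
  intro i hi S hS hR
  obtain ⟨⟨u, v⟩, huv⟩ : ∃ e : V × V, (σ ⟨m + i, by omega⟩ : V × V) = e := ⟨_, rfl⟩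
  have hn := last_notMem_permSeq σ hi
  have hs := permSeq_succ σ hi
  rw [huv] at hn hs
  have hE' := (hND (i + 1)).danglingIsolated
  have hq : lastEdgeLoad α σ i = pprWeight (insert (u, v) (permSeq σ i)) α u /
      outDeg (insert (u, v) (permSeq σ i)) u := by
    have hF := hND (i + 1)
    rw [hs] at hF
    simp only [lastEdgeLoad, hi, dif_pos, hs, hF, if_true, huv]
  rw [permUpdate_eq σ α t hi S huv]
  simp only [permGrowth, hi, dif_pos, huv, hs]
  rw [hs] at hE'
  exact sum_pprWeight_mul_abs_updateEdge_le hn (hND i).danglingIsolated hE' h0 h1 hε hS hR hq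

/-- The order is still fixed, and the bound is linear in the loads, so only their expectations
remain to be inserted. Having no dangling vertex gives n ≤ m, which absorbs the terms without
degrees. -/
theorem average_runningTime_permSeq_le [Nonempty V] {σ : Fin (m + k) ≃ E} (h0 : 0 < α)
    (h1 : α < 1) (hε : 0 < ε) (hε1 : ε < 1) (hσ : NoDangling (permSeq σ 0)) :
    (∑ t, runningTime (permSeq σ) (permUpdate σ α t) k α ε t) / (Fintype.card V : ℝ≥0∞) ≤
      ENNReal.ofReal (3 * (k / α) + 4 * ((m : ℝ) / Fintype.card V / (α * ε)) +
        ∑ i ∈ Finset.range k, lastEdgeLoad α σ i * (5 / α + 3 / (Fintype.card V * ε * α))) := by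
  rw [← Finset.card_univ]
  refine sum_runningTime_div_le Finset.univ_nonempty
    (fun t _ => runningTime_permSeq_le h0 h1 hε hσ t) (fun t _ => ?_) ?_
  · have e1 := Finset.sum_nonneg fun i (_ : i ∈ Finset.range k) =>
      permGrowth_nonneg h0 h1 hε σ i t
    have e2 := pprWeight_nonneg (permSeq σ 0) h0 h1 t
    positivity
  · rw [Finset.card_univ]
    set n : ℝ := (Fintype.card V : ℝ) with hn
    have hn0 : 0 < n := by rw [hn]; exact_mod_cast Fintype.card_pos
    have hcard := card_permSeq σ k.zero_le
    have hnm : n ≤ m := by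
      have := hσ.card_le
      rw [hcard, add_zero] at this
      rw [hn]
      exact_mod_cast this
    set q := lastEdgeLoad α σ with hq
    have hg : ∑ t, ∑ i ∈ Finset.range k, permGrowth α ε σ i t =
        k * (n * ε / α) + ∑ i ∈ Finset.range k, q i *
          (2 * n * ε / α + ((3 + 2 * ε * n) / α + ε * n)) := by
      rw [Finset.sum_comm, Finset.sum_congr rfl fun i hi =>
        sum_permGrowth h0 h1 σ (Finset.mem_range.1 hi)]
      have : (k : ℝ) * (n * ε / α) = ∑ i ∈ Finset.range k, n * ε / α := by simp
      rw [this, ← Finset.sum_add_distrib]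
      exact Finset.sum_congr rfl fun i _ => by ring
    obtain ⟨L, hL⟩ : ∃ L : ℝ, L = 2 + 2 * k := ⟨_, rfl⟩
    simp only [← hL]
    rw [Finset.sum_add_distrib, ← Finset.sum_div, Finset.sum_add_distrib, hg,
      sum_pprWeight _ h0 h1, hcard, ← Finset.sum_mul, ← Finset.sum_mul, Finset.sum_const,
      nsmul_eq_mul, Finset.card_univ, ← hn]
    set Q := ∑ i ∈ Finset.range k, q i with hQ
    have hQ0 : 0 ≤ Q := Finset.sum_nonneg fun i _ => lastEdgeLoad_nonneg h0 h1 σ i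
    have e1 : ((n + (m + 0 : ℕ)) / α + (k * (n * ε / α) +
        Q * (2 * n * ε / α + ((3 + 2 * ε * n) / α + ε * n)))) / ε =
          n / (α * ε) + m / (α * ε) + n * (k / α) +
            Q * (4 * n / α + 3 / (ε * α) + n) := by
      rw [add_zero]
      field_simp
      ring
    have e2 : n * (3 * (k / α) + 4 * (m / n / (α * ε)) + Q * (5 / α + 3 / (n * ε * α))) =
        3 * (n * (k / α)) + 4 * (m / (α * ε)) + Q * (5 * (n / α) + 3 / (ε * α)) := by
      field_simp
    have e3 : n ≤ n / α := by
      rw [le_div_iff₀ h0]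
      nlinarith
    have e4 : Q * (4 * n / α + 3 / (ε * α) + n) ≤ Q * (5 * (n / α) + 3 / (ε * α)) := by
      refine mul_le_mul_of_nonneg_left ?_ hQ0
      rw [mul_div_assoc]
      linarith
    have e5 : n / (α * ε) ≤ m / (α * ε) := by gcongr
    have e6 : n ≤ n / (α * ε) := by
      rw [le_div_iff₀ (by positivity)]
      have : α * ε ≤ 1 := by nlinarith
      nlinarith
    have e7 : n * k ≤ n * (k / α) := by
      refine mul_le_mul_of_nonneg_left ?_ hn0.le
      rw [le_div_iff₀ h0]
      have : (0 : ℝ) ≤ k := by positivity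
      nlinarith
    rw [e1, e2, hL]
    linarith

theorem expected_runningTime_permSeq_le [Nonempty V] (h0 : 0 < α) (h1 : α < 1) (hε : 0 < ε)
    (hε1 : ε < 1) (hE : E.card = m + k) :
    (∑ σ : Fin (m + k) ≃ E, if NoDangling (permSeq σ 0) then
        (∑ t, runningTime (permSeq σ) (permUpdate σ α t) k α ε t) / (Fintype.card V : ℝ≥0∞)
      else 0) / ((m + k).factorial : ℝ≥0∞) ≤
      ENNReal.ofReal (20 * (k / α ^ 2 + k / (Fintype.card V * ε * α ^ 2) +
        ((m : ℝ) / Fintype.card V) / (α * ε))) := by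
  have hcard : (Finset.univ : Finset (Fin (m + k) ≃ E)).card = (m + k).factorial := by
    rw [Finset.card_univ, Fintype.card_equiv (Fintype.equivOfCardEq (by simp [hE])),
      Fintype.card_fin]
  have hne : (Finset.univ : Finset (Fin (m + k) ≃ E)).Nonempty := by
    rw [← Finset.card_pos, hcard]
    exact Nat.factorial_pos _
  set n : ℝ := (Fintype.card V : ℝ) with hn
  have hn0 : 0 < n := by rw [hn]; exact_mod_cast Fintype.card_pos
  rw [← hcard]
  refine sum_runningTime_div_le hne (b := fun σ => 3 * (k / α) + 4 * ((m : ℝ) / n / (α * ε)) +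
    ∑ i ∈ Finset.range k, lastEdgeLoad α σ i * (5 / α + 3 / (n * ε * α)))
    (fun σ _ => ?_) (fun σ _ => ?_) ?_
  · split_ifs with hσ
    · exact average_runningTime_permSeq_le h0 h1 hε hε1 hσ
    · exact zero_le
  · have := Finset.sum_nonneg fun i (_ : i ∈ Finset.range k) => lastEdgeLoad_nonneg h0 h1 σ i
    rw [← Finset.sum_mul]
    positivity
  · rw [Finset.sum_add_distrib, Finset.sum_const, hcard, nsmul_eq_mul, Finset.sum_comm]
    have hs : ∑ i ∈ Finset.range k, ∑ σ : Fin (m + k) ≃ E,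
        lastEdgeLoad α σ i * (5 / α + 3 / (n * ε * α)) ≤
          k * ((m + k).factorial * (2 / α) * (5 / α + 3 / (n * ε * α))) := by
      refine (Finset.sum_le_card_nsmul _ _ ((m + k).factorial * (2 / α) *
        (5 / α + 3 / (n * ε * α))) fun i hi => ?_).trans (le_of_eq (by simp))
      rw [← Finset.sum_mul]
      exact mul_le_mul_of_nonneg_right
        (sum_lastEdgeLoad_le h0 h1 hE (Finset.mem_range.1 hi)) (by positivity)
    refine (add_le_add le_rfl hs).trans ?_
    -- The expected load 2/α turns the coefficients 5 and 3 into 10 and 6.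
    have e1 : (k : ℝ) * ((m + k).factorial * (2 / α) * (5 / α + 3 / (n * ε * α))) =
        (m + k).factorial * (10 * (k / α ^ 2) + 6 * (k / (n * ε * α ^ 2))) := by
      field_simp
      ring
    rw [e1, ← mul_add]
    refine mul_le_mul_of_nonneg_left ?_ (Nat.cast_nonneg _)
    have e2 : k / α ≤ k / α ^ 2 := by
      gcongr
      nlinarith
    have e3 : 0 ≤ k / (n * ε * α ^ 2) := by positivity
    have e4 : 0 ≤ (m : ℝ) / n / (α * ε) := by positivity
    have e5 : 0 ≤ k / α ^ 2 := by positivity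
    linarith

end Directed

end DynamicPush

/-! ### The two models together. -/

open DynamicPush in
theorem theorem5 :
    ∃ C : ℝ, 0 < C ∧ ∀ (α ε : ℝ), 0 < α → α < 1 → 0 < ε → ε < 1 →
      -- arbitrary edge updates of an undirected graph; `V` holds all vertices that ever occur,
      -- and `V₀` is the vertex set of the initial graph
      (∀ (V : Type*) [Fintype V] [DecidableEq V] (k : ℕ) (G₀ : SimpleGraph V) (V₀ : Finset V) (e : ℕ → V × V),
        V₀.Nonempty → (∀ x, x ∈ V₀ ↔ ∃ y, G₀.Adj x y) → (∀ i < k, (e i).1 ≠ (e i).2) →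
        (∀ t ∈ V₀, Accurate (undirSeq G₀ e) (undirUpdate G₀ e α t) k α ε t) ∧
        (∑ t ∈ V₀, runningTime (undirSeq G₀ e) (undirUpdate G₀ e α t) k α ε t) / (V₀.card : ℝ≥0∞) ≤
          ENNReal.ofReal (C * (k / α ^ 2 + k / (V₀.card * ε * α ^ 2) +
            ((∑ x ∈ V₀, (outDeg (arcs G₀) x : ℝ)) / V₀.card) / (α * ε)))) ∧
      -- uniformly random permutation of the edges of a directed graph on a fixed vertex set `V`
      (∀ (V : Type*) [Fintype V] [DecidableEq V] [Nonempty V] (m k : ℕ) (E : Finset (V × V)), E.card = m + k →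
        (∀ σ : Fin (m + k) ≃ E, NoDangling (permSeq σ 0) →
          ∀ t, Accurate (permSeq σ) (permUpdate σ α t) k α ε t) ∧
        (∑ σ : Fin (m + k) ≃ E, if NoDangling (permSeq σ 0) then
            (∑ t, runningTime (permSeq σ) (permUpdate σ α t) k α ε t) / (Fintype.card V : ℝ≥0∞)
          else 0) / ((m + k).factorial : ℝ≥0∞) ≤
          ENNReal.ofReal (C * (k / α ^ 2 + k / (Fintype.card V * ε * α ^ 2) +
            ((m : ℝ) / Fintype.card V) / (α * ε)))) := by
  -- The three terms of the bound need the coefficients 18, 12, 4 in the undirected model and 13, 6,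
  -- 4 in the directed one.
  refine ⟨20, by norm_num, fun α ε h0 h1 hε hε1 => ⟨?_, ?_⟩⟩
  · intro V _ _ k G₀ V₀ e hV₀ hG₀ he
    exact ⟨fun t _ => accurate_undirSeq h0 h1 hε he t,
      average_runningTime_undirSeq_le h0 h1 hε hε1 hV₀ hG₀ he⟩
  · intro V _ _ _ m k E hE
    exact ⟨fun σ hσ t => accurate_permSeq h0 h1 hε hσ t,
      expected_runningTime_permSeq_le h0 h1 hε hε1 hE⟩
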